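/- Let $(M,g)$ be a (nonempty) smooth Riemannian manifold of dimension $n\ge 2$ with constant sectional curvature $c$, let $A>0$ be a real number, and let $\lambda,\mu:[0,\infty)\to\mathbb R$ be smooth functions such that, for all $t\ge 0$, $$\lambda>0,\qquad \frac{A^2-2ct\lambda^2}{\lambda+2t\lambda'}>0,\qquad \lambda+2t\mu>0 .$$ On the cotangent bundle $T^*M$ use the charts $(q^i,p_i)$ induced by the charts of $M$ (summation convention), and put $g^{0i}=g^{ih}p_h$, $t=\tfrac12 g^{ik}p_ip_k$ (the energy density), $\frac{\delta}{\delta q^i}=\frac{\partial}{\partial q^i}+p_k\Gamma^k_{ih}\frac{\partial}{\partial p_h}$ and $Dp_i=dp_i-p_k\Gamma^k_{ij}dq^j$, where $\Gamma^k_{ij}$ are the Christoffel symbols of $g$. Let $J$ be the tensor field of type $(1,1)$ on $T^*M$ given by $$J\frac{\delta}{\delta q^i}=\Big(\frac{A}{\lambda}g_{ij}-\frac{c\lambda^3+A^2\lambda'}{A\lambda(\lambda+2t\lambda')}p_ip_j\Big)\frac{\partial}{\partial p_j},\qquad J\frac{\partial}{\partial p_i}=-\Big(\frac{\lambda}{A}g^{ij}+\frac{c\lambda^3+A^2\lambda'}{A(A^2-2ct\lambda^2)}g^{0i}g^{0j}\Big)\frac{\delta}{\delta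 q^j},$$ and let $G$ be the Riemannian metric on $T^*M$ given by $$G=(A\,g_{ij}+d_1p_ip_j)\,dq^idq^j+\Big(\frac{\lambda^2}{A}g^{ij}+d_2g^{0i}g^{0j}\Big)Dp_iDp_j,$$ $$d_1=\frac{-(c\lambda^3+A^2\lambda')+\mu(A^2-2ct\lambda^2)}{A(\lambda+2t\lambda')},\qquad d_2=\frac{\lambda(c\lambda^3+A^2\lambda')+\mu A^2(\lambda+2t\lambda')}{A(A^2-2ct\lambda^2)},$$ where $\lambda,\lambda',\mu$ are evaluated at the energy density $t$. Then the structure $(G,J)$ on $T^*M$ is Kähler (that is, it is a Hermitian structure with $J$ integrable, and its fundamental 2-form $\phi(X,Y)=G(X,JY)$ is closed) if and only if $\mu=\lambda'$ on $[0,\infty)$. -/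

import Mathlib

set_option maxSynthPendingDepth 3

open scoped Manifold ContDiff

noncomputable section

namespace CotangentBundle

/-! ### Two-tensors and almost complex structures on an open subset of a vector space -/

section TensorFields

variable {F : Type*} [NormedAddCommGroup F] [NormedSpace ℝ F]

/-- The Nijenhuis tensor
`N(X, Y) = [J X, J Y] - J [J X, Y] - J [X, J Y] - [X, Y]` of a field `J` of endomorphisms. -/
def nijenhuis (J : F → F →L[ℝ] F) (X Y : F → F) (z : F) : F :=
  VectorField.lieBracket ℝ (fun w => J w (X w)) (fun w => J w (Y w)) z
    - J z (VectorField.lieBracket ℝ (fun w => J w (X w)) Y z)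
    - J z (VectorField.lieBracket ℝ X (fun w => J w (Y w)) z)
    - VectorField.lieBracket ℝ X Y z

/-- `(G, J)` is a Hermitian structure on the open set `Ω`: `G` is a smooth Riemannian metric, `J`
is a smooth almost complex structure which is integrable (its Nijenhuis tensor vanishes), and
`G(J X, J Y) = G(X, Y)`. -/
structure IsHermitianOn (Ω : Set F) (G : F → F →L[ℝ] F →L[ℝ] ℝ) (J : F → F →L[ℝ] F) :
    Prop where
  contDiffOn_metric : ContDiffOn ℝ ∞ G Ω
  symm : ∀ z ∈ Ω, ∀ X Y : F, G z X Y = G z Y X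
  pos : ∀ z ∈ Ω, ∀ X : F, X ≠ 0 → 0 < G z X X
  contDiffOn_complex : ContDiffOn ℝ ∞ J Ω
  sq_eq_neg : ∀ z ∈ Ω, ∀ X : F, J z (J z X) = -X
  integrable : ∀ X Y : F → F, ContDiffOn ℝ ∞ X Ω → ContDiffOn ℝ ∞ Y Ω →
    ∀ z ∈ Ω, nijenhuis J X Y z = 0
  compatible : ∀ z ∈ Ω, ∀ X Y : F, G z (J z X) (J z Y) = G z X Y

/-- The fundamental form `φ(X, Y) = G(X, J Y)`. -/
def fundamentalForm (G : F → F →L[ℝ] F →L[ℝ] ℝ) (J : F → F →L[ℝ] F) (z X Y : F) : ℝ :=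
  G z X (J z Y)

/-- The 2-form `φ` is closed on the open set `Ω`: with respect to constant (coordinate) vector
fields `X, Y, Z`, one has `(dφ)(X, Y, Z) = X φ(Y, Z) + Y φ(Z, X) + Z φ(X, Y) = 0`. -/
def IsClosedFormOn (Ω : Set F) (φ : F → F → F → ℝ) : Prop :=
  ∀ z ∈ Ω, ∀ X Y Z : F,
    fderiv ℝ (fun w => φ w Y Z) z X + fderiv ℝ (fun w => φ w Z X) z Y
      + fderiv ℝ (fun w => φ w X Y) z Z = 0

/-- `(G, J)` is a Kähler structure on the open set `Ω`: it is a Hermitian structure and its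
fundamental form is closed. -/
structure IsKahlerOn (Ω : Set F) (G : F → F →L[ℝ] F →L[ℝ] ℝ) (J : F → F →L[ℝ] F) :
    Prop where
  isHermitianOn : IsHermitianOn Ω G J
  isClosedFormOn : IsClosedFormOn Ω (fundamentalForm G J)

end TensorFields

/-! ### Riemannian geometry in a chart

`b` is the expression `x ↦ (g_ij(x))` of a Riemannian metric in a chart with values in `E`. -/

section Chart

variable {E : Type*} [NormedAddCommGroup E] [NormedSpace ℝ E]

/-- The musical isomorphism `E* → E`, that is the inverse of `v ↦ b x v ·`. Its components are
the entries `g^{kl}(x)` of the inverse matrix. -/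
def sharp (b : E → E →L[ℝ] E →L[ℝ] ℝ) (x : E) : (E →L[ℝ] ℝ) →L[ℝ] E :=
  (b x).inverse

/-- The Christoffel symbols of the Levi-Civita connection, `Γ(u, v)^k = Γ^k_{ij} u^i v^j`:
`g(Γ(u, v), w) = ½ ((∂_u g)(v, w) + (∂_v g)(u, w) - (∂_w g)(u, v))`. -/
def christoffel (b : E → E →L[ℝ] E →L[ℝ] ℝ) (x : E) : E →L[ℝ] E →L[ℝ] E :=
  let D : E →L[ℝ] E →L[ℝ] E →L[ℝ] ℝ := fderiv ℝ b x
  let S : (E →L[ℝ] E →L[ℝ] ℝ) →L[ℝ] (E →L[ℝ] E →L[ℝ] ℝ) :=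
    (ContinuousLinearMap.flipₗᵢ ℝ E E ℝ).toContinuousLinearEquiv.toContinuousLinearMap
  let K : E →L[ℝ] E →L[ℝ] E →L[ℝ] ℝ := (1 / 2 : ℝ) • (D + D.flip - S ∘L D.flip)
  (ContinuousLinearMap.compL ℝ E (E →L[ℝ] ℝ) E (sharp b x)) ∘L K

theorem christoffel_apply (b : E → E →L[ℝ] E →L[ℝ] ℝ) (x u v : E) :
    christoffel b x u v = sharp b x ((1 / 2 : ℝ) • (fderiv ℝ b x u v + fderiv ℝ b x v u
      - ((fderiv ℝ b x).flip u).flip v)) := rfl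

/-- The curvature tensor `R(u, v) w`, where `R(∂_i, ∂_j) ∂_k = R^h_{kij} ∂_h` and
`R(X, Y) Z = ∇_X ∇_Y Z - ∇_Y ∇_X Z - ∇_{[X, Y]} Z`. -/
def curvature (b : E → E →L[ℝ] E →L[ℝ] ℝ) (x u v w : E) : E :=
  fderiv ℝ (christoffel b) x u v w - fderiv ℝ (christoffel b) x v u w
    + christoffel b x u (christoffel b x v w) - christoffel b x v (christoffel b x u w)

/-! ### The cotangent bundle in an induced chart

A chart `(q^i)` of the base with values in `E` induces the chart `(q^i, p_i)` of the cotangent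
bundle, with values in `E × E*`; a point is `z = (q, p)`, and a tangent vector at `z` is again an
element of `E × E*`. -/

/-- The energy density `t = ½ ‖p‖² = ½ g^{ik} p_i p_k`. -/
def energy (b : E → E →L[ℝ] E →L[ℝ] ℝ) (z : E × (E →L[ℝ] ℝ)) : ℝ :=
  1 / 2 * z.2 (sharp b z.1 z.2)

/-- The horizontal lift: `e_i ↦ δ/δq^i = ∂/∂q^i + p_k Γ^k_{ih} ∂/∂p_h`. -/
def horizontalLift (b : E → E →L[ℝ] E →L[ℝ] ℝ) (z : E × (E →L[ℝ] ℝ)) :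
    E →L[ℝ] E × (E →L[ℝ] ℝ) :=
  (ContinuousLinearMap.id ℝ E).prod
    ((ContinuousLinearMap.compL ℝ E E ℝ z.2) ∘L christoffel b z.1)

/-- The vertical lift: `e^i ↦ ∂/∂p_i`. -/
def verticalLift (E : Type*) [NormedAddCommGroup E] [NormedSpace ℝ E] :
    (E →L[ℝ] ℝ) →L[ℝ] E × (E →L[ℝ] ℝ) :=
  ContinuousLinearMap.inr ℝ E (E →L[ℝ] ℝ)

/-- The covector-valued 1-form `dq^i`. -/
def dq (E : Type*) [NormedAddCommGroup E] [NormedSpace ℝ E] :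
    E × (E →L[ℝ] ℝ) →L[ℝ] E :=
  ContinuousLinearMap.fst ℝ E (E →L[ℝ] ℝ)

/-- The 1-form `Dp_i = dp_i - p_k Γ^k_{ij} dq^j`. -/
def Dp (b : E → E →L[ℝ] E →L[ℝ] ℝ) (z : E × (E →L[ℝ] ℝ)) :
    E × (E →L[ℝ] ℝ) →L[ℝ] (E →L[ℝ] ℝ) :=
  ContinuousLinearMap.snd ℝ E (E →L[ℝ] ℝ)
    - (ContinuousLinearMap.compL ℝ E E ℝ z.2) ∘L christoffel b z.1 ∘L dq E

/-- The tensor `u(t) g_ij + v(t) p_i p_j`. -/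
def lowerTensor (b : E → E →L[ℝ] E →L[ℝ] ℝ) (u v : ℝ → ℝ) (z : E × (E →L[ℝ] ℝ)) :
    E →L[ℝ] E →L[ℝ] ℝ :=
  u (energy b z) • b z.1 + v (energy b z) • z.2.smulRight z.2

/-- The tensor `u(t) g^{ij} + v(t) g^{0i} g^{0j}`, where `g^{0i} = p_h g^{hi}`, as a map
from covectors to vectors. -/
def upperTensor (b : E → E →L[ℝ] E →L[ℝ] ℝ) (u v : ℝ → ℝ) (z : E × (E →L[ℝ] ℝ)) :
    (E →L[ℝ] ℝ) →L[ℝ] E :=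
  u (energy b z) • sharp b z.1
    + v (energy b z) •
      (ContinuousLinearMap.apply ℝ ℝ (sharp b z.1 z.2)).smulRight (sharp b z.1 z.2)

/-- The natural tensor field `J` of diagonal type with
`J δ/δq^i = (a₁ g_ij + b₁ p_i p_j) ∂/∂p_j` and
`J ∂/∂p_i = -(a₂ g^{ij} + b₂ g^{0i} g^{0j}) δ/δq^j`. -/
def diagonalJ (b : E → E →L[ℝ] E →L[ℝ] ℝ) (a₁ b₁ a₂ b₂ : ℝ → ℝ) (z : E × (E →L[ℝ] ℝ)) :
    E × (E →L[ℝ] ℝ) →L[ℝ] E × (E →L[ℝ] ℝ) :=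
  verticalLift E ∘L lowerTensor b a₁ b₁ z ∘L dq E
    - horizontalLift b z ∘L upperTensor b a₂ b₂ z ∘L Dp b z

/-- The natural metric of diagonal type
`G = (c₁ g_ij + d₁ p_i p_j) dq^i dq^j + (c₂ g^{ij} + d₂ g^{0i} g^{0j}) Dp_i Dp_j`. -/
def diagonalG (b : E → E →L[ℝ] E →L[ℝ] ℝ) (c₁ d₁ c₂ d₂ : ℝ → ℝ) (z : E × (E →L[ℝ] ℝ)) :
    E × (E →L[ℝ] ℝ) →L[ℝ] E × (E →L[ℝ] ℝ) →L[ℝ] ℝ :=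
  (lowerTensor b c₁ d₁ z).bilinearComp (dq E) (dq E)
    + (ContinuousLinearMap.compL ℝ (E × (E →L[ℝ] ℝ)) E ℝ).flip
        (upperTensor b c₂ d₂ z ∘L Dp b z) ∘L Dp b z

theorem diagonalJ_apply (b : E → E →L[ℝ] E →L[ℝ] ℝ) (a₁ b₁ a₂ b₂ : ℝ → ℝ)
    (z X : E × (E →L[ℝ] ℝ)) :
    diagonalJ b a₁ b₁ a₂ b₂ z X = verticalLift E (lowerTensor b a₁ b₁ z X.1)
      - horizontalLift b z (upperTensor b a₂ b₂ z (Dp b z X)) := rfl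

theorem diagonalG_apply (b : E → E →L[ℝ] E →L[ℝ] ℝ) (c₁ d₁ c₂ d₂ : ℝ → ℝ)
    (z X Y : E × (E →L[ℝ] ℝ)) :
    diagonalG b c₁ d₁ c₂ d₂ z X Y = lowerTensor b c₁ d₁ z X.1 Y.1
      + Dp b z X (upperTensor b c₂ d₂ z (Dp b z Y)) := rfl

end Chart

/-! ### The coefficients

The functions of `t ∈ [0, ∞)` are represented by functions `ℝ → ℝ`, of which only the values on
`[0, ∞)` matter; `λ'` is the derivative on `[0, ∞)` (one-sided at `0`). -/

/-- The derivative of a function on `[0, ∞)`. -/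
def deriv₀ (f : ℝ → ℝ) (t : ℝ) : ℝ := derivWithin f (Set.Ici 0) t

/-- `a₁ = A / λ`. -/
def coeffA₁ (A : ℝ) (lam : ℝ → ℝ) (t : ℝ) : ℝ := A / lam t

/-- `b₁ = -(c λ³ + A² λ') / (A λ (λ + 2 t λ'))`. -/
def coeffB₁ (A c : ℝ) (lam : ℝ → ℝ) (t : ℝ) : ℝ :=
  -((c * lam t ^ 3 + A ^ 2 * deriv₀ lam t) / (A * lam t * (lam t + 2 * t * deriv₀ lam t)))

/-- `a₂ = λ / A`. -/
def coeffA₂ (A : ℝ) (lam : ℝ → ℝ) (t : ℝ) : ℝ := lam t / A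

/-- `b₂ = (c λ³ + A² λ') / (A (A² - 2 c t λ²))`. -/
def coeffB₂ (A c : ℝ) (lam : ℝ → ℝ) (t : ℝ) : ℝ :=
  (c * lam t ^ 3 + A ^ 2 * deriv₀ lam t) / (A * (A ^ 2 - 2 * c * t * lam t ^ 2))

/-- `c₁ = A`. -/
def coeffC₁ (A : ℝ) (_t : ℝ) : ℝ := A

/-- `d₁ = (-(c λ³ + A² λ') + μ (A² - 2 c t λ²)) / (A (λ + 2 t λ'))`. -/
def coeffD₁ (A c : ℝ) (lam mu : ℝ → ℝ) (t : ℝ) : ℝ :=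
  (-(c * lam t ^ 3 + A ^ 2 * deriv₀ lam t) + mu t * (A ^ 2 - 2 * c * t * lam t ^ 2))
    / (A * (lam t + 2 * t * deriv₀ lam t))

/-- `c₂ = λ² / A`. -/
def coeffC₂ (A : ℝ) (lam : ℝ → ℝ) (t : ℝ) : ℝ := lam t ^ 2 / A

/-- `d₂ = (λ (c λ³ + A² λ') + μ A² (λ + 2 t λ')) / (A (A² - 2 c t λ²))`. -/
def coeffD₂ (A c : ℝ) (lam mu : ℝ → ℝ) (t : ℝ) : ℝ :=
  (lam t * (c * lam t ^ 3 + A ^ 2 * deriv₀ lam t)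
      + mu t * A ^ 2 * (lam t + 2 * t * deriv₀ lam t))
    / (A * (A ^ 2 - 2 * c * t * lam t ^ 2))

/-! ### Riemannian manifolds and their cotangent bundles -/

section Manifold

variable {n : ℕ} {M : Type*} [TopologicalSpace M] [ChartedSpace (EuclideanSpace ℝ (Fin n)) M]
  [IsManifold (𝓡 n) ∞ M]

/-- The expression of the Riemannian metric `g` in the chart `e` of the manifold `M`. -/
def metricInChart
    (g : Bundle.ContMDiffRiemannianMetric (𝓡 n) ∞ (EuclideanSpace ℝ (Fin n))
      (fun x : M => TangentSpace (𝓡 n) x))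
    (e : OpenPartialHomeomorph M (EuclideanSpace ℝ (Fin n))) (x : EuclideanSpace ℝ (Fin n)) :
    EuclideanSpace ℝ (Fin n) →L[ℝ] EuclideanSpace ℝ (Fin n) →L[ℝ] ℝ :=
  let D : EuclideanSpace ℝ (Fin n) →L[ℝ] EuclideanSpace ℝ (Fin n) :=
    mfderiv (𝓡 n) (𝓡 n) e.symm x
  let G : EuclideanSpace ℝ (Fin n) →L[ℝ] EuclideanSpace ℝ (Fin n) →L[ℝ] ℝ :=
    g.inner (e.symm x)
  G.bilinearComp D D

theorem metricInChart_apply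
    (g : Bundle.ContMDiffRiemannianMetric (𝓡 n) ∞ (EuclideanSpace ℝ (Fin n))
      (fun x : M => TangentSpace (𝓡 n) x))
    (e : OpenPartialHomeomorph M (EuclideanSpace ℝ (Fin n)))
    (x u v : EuclideanSpace ℝ (Fin n)) :
    metricInChart g e x u v = g.inner (e.symm x) (mfderiv (𝓡 n) (𝓡 n) e.symm x u)
      (mfderiv (𝓡 n) (𝓡 n) e.symm x v) := rfl

/-- `(M, g)` has constant sectional curvature `c`:
`g(R(u, v) v, u) = c (g(u, u) g(v, v) - g(u, v)²)` for all tangent vectors `u, v`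
(both sides vanish when `u, v` are linearly dependent). -/
def HasConstantSectionalCurvature
    (g : Bundle.ContMDiffRiemannianMetric (𝓡 n) ∞ (EuclideanSpace ℝ (Fin n))
      (fun x : M => TangentSpace (𝓡 n) x)) (c : ℝ) : Prop :=
  ∀ e ∈ IsManifold.maximalAtlas (𝓡 n) ∞ M, ∀ x ∈ e.target, ∀ u v : EuclideanSpace ℝ (Fin n),
    metricInChart g e x (curvature (metricInChart g e) x u v v) u
      = c * (metricInChart g e x u u * metricInChart g e x v v
          - metricInChart g e x u v ^ 2)

/-- The natural structure `(G, J)` of diagonal type on the cotangent bundle of `(M, g)` determined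
by the constants `A, c` and the functions `λ, μ` is Kähler. The tensor fields `G`, `J` on the
cotangent bundle are given by their expressions in the charts induced by the charts
`e : U → e.target` of `M`; the induced chart maps `π⁻¹(U)` onto `e.target × E*`. -/
def IsNaturalKahler
    (g : Bundle.ContMDiffRiemannianMetric (𝓡 n) ∞ (EuclideanSpace ℝ (Fin n))
      (fun x : M => TangentSpace (𝓡 n) x)) (A c : ℝ) (lam mu : ℝ → ℝ) : Prop :=
  ∀ e ∈ IsManifold.maximalAtlas (𝓡 n) ∞ M,
    IsKahlerOn (e.target ×ˢ Set.univ)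
      (diagonalG (metricInChart g e) (coeffC₁ A) (coeffD₁ A c lam mu) (coeffC₂ A lam)
        (coeffD₂ A c lam mu))
      (diagonalJ (metricInChart g e) (coeffA₁ A lam) (coeffB₁ A c lam) (coeffA₂ A lam)
        (coeffB₂ A c lam))

end Manifold

end CotangentBundle

end

/-! In the frame of horizontal and vertical lifts everything reduces to scalar functions of the
energy `t`, because `p(♯p) = 2t` keeps compositions of tensors `u g + v p⊗p` in the same family.

The structure is Hermitian whatever `μ` is. The two blocks of `J` are inverse to each other, so `J²
= -1`. Vertical vectors are images under `J` of horizontal ones, so by `nijenhuisForm_eq_zero`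
integrability need only be tested on horizontal lifts `δ_u, δ_v`. The mixed brackets cancel because
the Levi-Civita connection is metric and torsion-free. The bracket `[δ_u, δ_v]` is the vertical
covector `p ∘ R(u, v)`, which in constant curvature is `c (p(u) g(v, ·) - p(v) g(u, ·))`; and
`[Jδ_u, Jδ_v]` is the same covector with factor `a₁' (a₁ + 2 t b₁) - a₁ b₁`, which the given
coefficients make equal to `c`.

The blocks of `G` and `J` combine to `φ = λ dp_i ∧ dq^i + μ dt ∧ p_i dq^i` (`fundamentalForm_eq`),
whence `dφ = (λ' - μ) dt ∧ dp_i ∧ dq^i` (`exteriorDerivative_fundamentalForm`). For `n ≥ 2` the last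
3-form is nonzero wherever `p ≠ 0`, so closedness forces `μ = λ'` for `t > 0`, and continuity
extends this to `t = 0`. -/

noncomputable section

namespace CotangentBundle

/-! ### Levi-Civita connection and curvature in a chart -/

section ChartGeometry

variable {E : Type*} [NormedAddCommGroup E] [NormedSpace ℝ E]

/-- `b` is the local expression of a smooth Riemannian metric on the open set `U`. -/
structure IsRiemannianOn (U : Set E) (b : E → E →L[ℝ] E →L[ℝ] ℝ) : Prop where
  isOpen : IsOpen U
  contDiffOn : ContDiffOn ℝ ∞ b U
  symm : ∀ x ∈ U, ∀ u v : E, b x u v = b x v u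
  pos : ∀ x ∈ U, ∀ u : E, u ≠ 0 → 0 < b x u u

omit [NormedSpace ℝ E] in
/-- A multilinear form with the symmetries of a curvature tensor vanishes if its sectional
curvatures do. -/
theorem eq_zero_of_sectional_eq_zero {Q : E → E → E → E → ℝ}
    (h_add₂ : ∀ u v v' w z, Q u (v + v') w z = Q u v w z + Q u v' w z)
    (h_swap : ∀ u v w z, Q v u w z = -Q u v w z)
    (h_skew : ∀ u v w z, Q u v z w = -Q u v w z)
    (h_bianchi : ∀ u v w z, Q u v w z + Q v w u z + Q w u v z = 0)
    (h_add₃ : ∀ u v w w' z, Q u v (w + w') z = Q u v w z + Q u v w' z)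
    (h_sec : ∀ u v, Q u v v u = 0) (u v w z : E) : Q u v w z = 0 := by
  -- Pair symmetry: the classical combination of four Bianchi identities.
  have h_pair : ∀ u v w z, Q u v w z = Q w z u v := by
    intro u v w z
    linarith [h_bianchi u v w z, h_bianchi v w z u, h_bianchi w z u v, h_bianchi z u v w,
      h_swap u v w z, h_swap u v z w, h_swap v w z u, h_swap v w u z, h_swap w z u v,
      h_swap w z v u, h_swap z u v w, h_swap z u w v, h_swap u w v z, h_swap u w z v,
      h_swap v z u w, h_swap v z w u, h_swap w u v z, h_swap w u z v,
      h_skew u v w z, h_skew v w u z, h_skew w z u v, h_skew z u v w, h_skew u w v z,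
      h_skew v z u w, h_skew w u v z, h_skew z v u w]
  -- Polarize in `v`; pair symmetry makes the two cross terms equal.
  have h₁ : ∀ u v w, Q u v w u = 0 := by
    intro u v w
    have h := h_sec u (v + w)
    rw [h_add₂, h_add₃, h_add₃, h_sec, h_sec] at h
    linarith [h_pair u v w u, h_swap w u u v, h_skew w u v u, h_swap u w u v,
      h_skew u w v u]
  -- Polarize in `u`, after moving it to the second and third slots, where additivity is assumed.
  have h₂ : ∀ u v w z, Q u v w z = -Q z v w u := by
    intro u v w z
    have h := h₁ (u + z) v w
    have h' : Q (u + z) v w (u + z) = Q v (u + z) (u + z) w := by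
      linarith [h_swap (u + z) v w (u + z), h_skew (u + z) v w (u + z),
        h_swap (u + z) v (u + z) w]
    rw [h', h_add₂, h_add₃, h_add₃] at h
    linarith [h_swap u v u w, h_skew u v u w, h_swap z v z w, h_skew z v z w, h₁ u v w, h₁ z v w,
      h_swap u v z w, h_skew u v z w, h_swap z v u w, h_skew z v u w]
  -- `Q` is now totally alternating, so the Bianchi identity reads `3 Q = 0`.
  linarith [h_bianchi u v w z, h₂ u v w z, h₂ v w u z, h₂ w u v z, h_swap z v w u, h_swap u v w z,
    h₂ v z w u, h_swap v z w u, h_swap u z w v, h₂ u w v z, h₂ z u w v, h_swap z u w v,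
    h₂ v u w z, h_swap u w v z, h_swap v w u z, h_pair u v w z, h_pair v w u z, h_pair w u v z,
    h_skew u v w z, h_swap w z u v, h_skew w z u v, h_swap u z v w, h_skew u z v w]

namespace IsRiemannianOn

variable {U : Set E} {b : E → E →L[ℝ] E →L[ℝ] ℝ} {x : E}

theorem differentiableAt (hb : IsRiemannianOn U b) (hx : x ∈ U) : DifferentiableAt ℝ b x :=
  (hb.contDiffOn.contDiffAt (hb.isOpen.mem_nhds hx)).differentiableAt (by simp)

theorem contDiffOn_fderiv (hb : IsRiemannianOn U b) : ContDiffOn ℝ ∞ (fderiv ℝ b) U :=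
  hb.contDiffOn.fderiv_of_isOpen hb.isOpen (by simp)

theorem fderiv_symm (hb : IsRiemannianOn U b) (hx : x ∈ U) (u v w : E) :
    fderiv ℝ b x u v w = fderiv ℝ b x u w v := by
  have h : ∀ v w, HasFDerivAt (fun y => b y v w) ((fderiv ℝ b x).flip v |>.flip w) x := by
    intro v w
    have := (hb.differentiableAt hx).hasFDerivAt
    refine ((this.clm_apply (hasFDerivAt_const v x)).clm_apply
      (hasFDerivAt_const w x)).congr_fderiv ?_
    ext; simp
  have h₂ := (h w v).congr_of_eventuallyEq (f₁ := fun y => b y v w) (by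
    filter_upwards [hb.isOpen.mem_nhds hx] with y hy using hb.symm y hy v w)
  have := DFunLike.congr_fun ((h v w).unique h₂) u
  simpa using this

variable [FiniteDimensional ℝ E]

theorem isInvertible (hb : IsRiemannianOn U b) (hx : x ∈ U) : (b x).IsInvertible := by
  have hinj : Function.Injective (b x) := by
    rw [injective_iff_map_eq_zero]
    intro v hv
    by_contra hne
    have := hb.pos x hx v hne
    simp [hv] at this
  have hdim : Module.finrank ℝ E = Module.finrank ℝ (E →L[ℝ] ℝ) := by
    rw [← (LinearMap.toContinuousLinearMap (𝕜 := ℝ) (E := E) (F' := ℝ)).finrank_eq]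
    exact (Subspace.dual_finrank_eq (K := ℝ) (V := E)).symm
  exact ⟨(LinearEquiv.ofInjectiveOfFinrankEq (b x : E →ₗ[ℝ] (E →L[ℝ] ℝ)) hinj
    hdim).toContinuousLinearEquiv, by ext; rfl⟩

theorem apply_sharp (hb : IsRiemannianOn U b) (hx : x ∈ U) (p : E →L[ℝ] ℝ) :
    b x (sharp b x p) = p := (hb.isInvertible hx).self_apply_inverse p

theorem sharp_apply (hb : IsRiemannianOn U b) (hx : x ∈ U) (v : E) :
    sharp b x (b x v) = v := (hb.isInvertible hx).inverse_apply_self v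

theorem ext_of_metric (hb : IsRiemannianOn U b) (hx : x ∈ U) {v w : E}
    (h : ∀ z, b x v z = b x w z) : v = w :=
  (hb.isInvertible hx).injective (ContinuousLinearMap.ext h)

theorem apply_sharp_eq (hb : IsRiemannianOn U b) (hx : x ∈ U) (p : E →L[ℝ] ℝ) (v : E) :
    b x v (sharp b x p) = p v := by
  rw [hb.symm x hx, hb.apply_sharp hx]

theorem sharp_symm (hb : IsRiemannianOn U b) (hx : x ∈ U) (p q : E →L[ℝ] ℝ) :
    p (sharp b x q) = q (sharp b x p) := by
  rw [← hb.apply_sharp_eq hx p, hb.apply_sharp hx]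

theorem contDiffOn_sharp (hb : IsRiemannianOn U b) : ContDiffOn ℝ ∞ (sharp b) U := by
  have : CompleteSpace E := FiniteDimensional.complete ℝ E
  intro x hx
  exact ((hb.isInvertible hx).contDiffAt_map_inverse).comp_contDiffWithinAt x (hb.contDiffOn x hx)

theorem apply_christoffel (hb : IsRiemannianOn U b) (hx : x ∈ U) (u v w : E) :
    b x (christoffel b x u v) w
      = 1 / 2 * (fderiv ℝ b x u v w + fderiv ℝ b x v u w - fderiv ℝ b x w u v) := by
  rw [christoffel_apply, hb.apply_sharp hx]
  simp

theorem christoffel_symm (hb : IsRiemannianOn U b) (hx : x ∈ U) (u v : E) :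
    christoffel b x u v = christoffel b x v u := by
  refine hb.ext_of_metric hx fun w => ?_
  rw [hb.apply_christoffel hx, hb.apply_christoffel hx, hb.fderiv_symm hx w u v]
  ring

/-- Metric compatibility `∇g = 0`: all but one derivative cancel when two Koszul formulas are added.
-/
theorem fderiv_metric (hb : IsRiemannianOn U b) (hx : x ∈ U) (u v w : E) :
    fderiv ℝ b x u v w = b x (christoffel b x u v) w + b x v (christoffel b x u w) := by
  rw [hb.symm x hx v, hb.apply_christoffel hx, hb.apply_christoffel hx,
    hb.fderiv_symm hx w u v, hb.fderiv_symm hx v u w, hb.fderiv_symm hx u w v]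
  ring

theorem contDiffOn_christoffel (hb : IsRiemannianOn U b) : ContDiffOn ℝ ∞ (christoffel b) U := by
  rw [contDiffOn_clm_apply]
  intro u
  rw [contDiffOn_clm_apply]
  intro v
  have hD := hb.contDiffOn_fderiv
  have h₁ : ∀ u v : E, ContDiffOn ℝ ∞ (fun x => fderiv ℝ b x u v) U := fun u v =>
    (hD.clm_apply contDiffOn_const).clm_apply contDiffOn_const
  have h₂ : ContDiffOn ℝ ∞ (fun x => ((fderiv ℝ b x).flip u).flip v) U := by
    rw [contDiffOn_clm_apply]
    intro w
    exact (h₁ w u).clm_apply contDiffOn_const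
  exact hb.contDiffOn_sharp.clm_apply
    (contDiffOn_const.smul (((h₁ u v).add (h₁ v u)).sub h₂))

theorem differentiableAt_christoffel (hb : IsRiemannianOn U b) (hx : x ∈ U) :
    DifferentiableAt ℝ (christoffel b) x :=
  (hb.contDiffOn_christoffel.contDiffAt (hb.isOpen.mem_nhds hx)).differentiableAt (by simp)

theorem fderiv_christoffel_symm (hb : IsRiemannianOn U b) (hx : x ∈ U) (u v w : E) :
    fderiv ℝ (christoffel b) x u v w = fderiv ℝ (christoffel b) x u w v := by
  have h : ∀ v w, HasFDerivAt (fun y => christoffel b y v w)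
      ((fderiv ℝ (christoffel b) x).flip v |>.flip w) x := by
    intro v w
    refine (((hb.differentiableAt_christoffel hx).hasFDerivAt.clm_apply
      (hasFDerivAt_const v x)).clm_apply (hasFDerivAt_const w x)).congr_fderiv ?_
    ext; simp
  have h₂ := (h w v).congr_of_eventuallyEq (f₁ := fun y => christoffel b y v w) (by
    filter_upwards [hb.isOpen.mem_nhds hx] with y hy using hb.christoffel_symm hy v w)
  simpa using DFunLike.congr_fun ((h v w).unique h₂) u

/-- Torsion-freeness, for `Γ` and for its derivative, cancels the terms in pairs. -/
theorem curvature_bianchi (hb : IsRiemannianOn U b) (hx : x ∈ U) (u v w : E) :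
    curvature b x u v w + curvature b x v w u + curvature b x w u v = 0 := by
  simp only [curvature]
  rw [hb.fderiv_christoffel_symm hx u w v, hb.fderiv_christoffel_symm hx v u w,
    hb.fderiv_christoffel_symm hx w v u, hb.christoffel_symm hx w v, hb.christoffel_symm hx u w,
    hb.christoffel_symm hx v u]
  abel

omit [FiniteDimensional ℝ E] in
theorem curvature_swap (b : E → E →L[ℝ] E →L[ℝ] ℝ) (x u v w : E) :
    curvature b x v u w = -curvature b x u v w := by
  simp only [curvature]
  abel

theorem snd_fderiv_metric (hb : IsRiemannianOn U b) (hx : x ∈ U) (u v w z : E) :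
    fderiv ℝ (fderiv ℝ b) x v u w z
      = fderiv ℝ b x v (christoffel b x u w) z + b x (fderiv ℝ (christoffel b) x v u w) z
        + (fderiv ℝ b x v w (christoffel b x u z)
          + b x w (fderiv ℝ (christoffel b) x v u z)) := by
  have hΓ := (hb.differentiableAt_christoffel hx).hasFDerivAt
  have hB := (hb.differentiableAt hx).hasFDerivAt
  have hD := ((hb.contDiffOn_fderiv.contDiffAt (hb.isOpen.mem_nhds hx)).differentiableAt
    (by simp)).hasFDerivAt
  have c : ∀ a : E, HasFDerivAt (fun _ : E => a) (0 : E →L[ℝ] E) x := fun a =>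
    hasFDerivAt_const a x
  have h₁ := ((hD.clm_apply (c u)).clm_apply (c w)).clm_apply (c z)
  have h₂ := ((hB.clm_apply ((hΓ.clm_apply (c u)).clm_apply (c w))).clm_apply (c z)).add
    ((hB.clm_apply (c w)).clm_apply ((hΓ.clm_apply (c u)).clm_apply (c z)))
  have h₃ := h₁.congr_of_eventuallyEq
    (f₁ := fun y => b y (christoffel b y u w) z + b y w (christoffel b y u z)) (by
      filter_upwards [hb.isOpen.mem_nhds hx] with y hy using (hb.fderiv_metric hy u w z).symm)
  have := DFunLike.congr_fun (h₃.unique h₂) v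
  simp at this
  rw [this]
  ring

/-- The Ricci identity applied to `∇g = 0`: second derivatives of `g` commute, and expanding both
orders through `Γ` leaves only curvature terms. -/
theorem curvature_skew (hb : IsRiemannianOn U b) (hx : x ∈ U) (u v w z : E) :
    b x (curvature b x u v w) z = -b x (curvature b x u v z) w := by
  have hs : fderiv ℝ (fderiv ℝ b) x v u = fderiv ℝ (fderiv ℝ b) x u v :=
    ((hb.contDiffOn.contDiffAt (hb.isOpen.mem_nhds hx)).isSymmSndFDerivAt
      (by rw [minSmoothness_of_isRCLikeNormedField]; exact WithTop.coe_le_coe.2 le_top)).eq v u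
  have h := hb.snd_fderiv_metric hx u v w z
  rw [hs, hb.snd_fderiv_metric hx v u w z] at h
  simp only [hb.fderiv_metric hx] at h
  simp only [curvature, map_add, map_sub, _root_.add_apply,
    _root_.sub_apply]
  simp only [hb.symm x hx w] at h
  linarith

/-- On a space of constant sectional curvature,
`R(u, v) w = c (g(v, w) u - g(u, w) v)`. -/
theorem curvature_eq (hb : IsRiemannianOn U b) (hx : x ∈ U) {c : ℝ}
    (hc : ∀ u v : E, b x (curvature b x u v v) u = c * (b x u u * b x v v - b x u v ^ 2))
    (u v w : E) :
    curvature b x u v w = c • (b x v w • u - b x u w • v) := by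
  refine hb.ext_of_metric hx fun z => ?_
  -- `Q` is the difference between the curvature form and its constant curvature model; it has all
  -- the curvature symmetries and zero sectional curvature.
  have key := eq_zero_of_sectional_eq_zero
    (Q := fun u v w z => b x (curvature b x u v w) z
      - c * (b x v w * b x u z - b x u w * b x v z))
    (fun u v v' w z => by simp [curvature]; ring)
    (fun u v w z => by rw [curvature_swap]; simp; ring)
    (fun u v w z => by rw [hb.curvature_skew hx]; ring)
    (fun u v w z => by
      have h := congrArg (fun a => b x a z) (hb.curvature_bianchi hx u v w)
      simp only [map_add, _root_.add_apply, map_zero,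
        _root_.zero_apply] at h
      rw [hb.symm x hx w v, hb.symm x hx u w, hb.symm x hx v u]
      linarith)
    (fun u v w w' z => by simp [curvature]; ring)
    (fun u v => by rw [hc, hb.symm x hx v u]; ring) u v w z
  simp only [map_smul, map_sub, _root_.smul_apply, _root_.sub_apply,
    smul_eq_mul]
  linarith

end IsRiemannianOn

end ChartGeometry

/-! ### Lifts, the energy density and smoothness of the natural tensors -/

section Energy

variable {E : Type*} [NormedAddCommGroup E] [NormedSpace ℝ E]

theorem Dp_apply (b : E → E →L[ℝ] E →L[ℝ] ℝ) (z X : E × (E →L[ℝ] ℝ)) (v : E) :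
    Dp b z X v = X.2 v - z.2 (christoffel b z.1 X.1 v) := rfl

theorem horizontalLift_fst (b : E → E →L[ℝ] E →L[ℝ] ℝ) (z : E × (E →L[ℝ] ℝ)) (u : E) :
    (horizontalLift b z u).1 = u := rfl

theorem horizontalLift_snd (b : E → E →L[ℝ] E →L[ℝ] ℝ) (z : E × (E →L[ℝ] ℝ)) (u v : E) :
    (horizontalLift b z u).2 v = z.2 (christoffel b z.1 u v) := rfl

theorem Dp_horizontalLift (b : E → E →L[ℝ] E →L[ℝ] ℝ) (z : E × (E →L[ℝ] ℝ)) (u : E) :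
    Dp b z (horizontalLift b z u) = 0 := by
  ext v
  rw [Dp_apply, horizontalLift_snd, horizontalLift_fst, sub_self, zero_apply]

theorem Dp_verticalLift (b : E → E →L[ℝ] E →L[ℝ] ℝ) (z : E × (E →L[ℝ] ℝ)) (α : E →L[ℝ] ℝ) :
    Dp b z (verticalLift E α) = α := by
  ext v
  simp [Dp_apply, verticalLift]

theorem horizontalLift_add_verticalLift (b : E → E →L[ℝ] E →L[ℝ] ℝ) (z X : E × (E →L[ℝ] ℝ)) :
    horizontalLift b z X.1 + verticalLift E (Dp b z X) = X := by
  refine Prod.ext ?_ ?_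
  · simp [horizontalLift_fst, verticalLift]
  · ext v
    simp [horizontalLift_snd, verticalLift, Dp_apply]

theorem lowerTensor_apply (b : E → E →L[ℝ] E →L[ℝ] ℝ) (f h : ℝ → ℝ) (z : E × (E →L[ℝ] ℝ))
    (u v : E) :
    lowerTensor b f h z u v = f (energy b z) * b z.1 u v + h (energy b z) * (z.2 u * z.2 v) := rfl

theorem upperTensor_apply (b : E → E →L[ℝ] E →L[ℝ] ℝ) (f h : ℝ → ℝ) (z : E × (E →L[ℝ] ℝ))
    (α : E →L[ℝ] ℝ) :
    upperTensor b f h z α = f (energy b z) • sharp b z.1 α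
      + h (energy b z) • α (sharp b z.1 z.2) • sharp b z.1 z.2 := rfl

theorem apply_sharp_self (b : E → E →L[ℝ] E →L[ℝ] ℝ) (z : E × (E →L[ℝ] ℝ)) :
    z.2 (sharp b z.1 z.2) = 2 * energy b z := by
  rw [energy]; ring

/-- The differential of the energy density, `dt = g^{0i} Dp_i`. -/
def energyForm (b : E → E →L[ℝ] E →L[ℝ] ℝ) (z : E × (E →L[ℝ] ℝ)) :
    E × (E →L[ℝ] ℝ) →L[ℝ] ℝ :=
  ContinuousLinearMap.apply ℝ ℝ (sharp b z.1 z.2) ∘L Dp b z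

theorem energyForm_apply (b : E → E →L[ℝ] E →L[ℝ] ℝ) (z X : E × (E →L[ℝ] ℝ)) :
    energyForm b z X = Dp b z X (sharp b z.1 z.2) := rfl

theorem energyForm_horizontalLift (b : E → E →L[ℝ] E →L[ℝ] ℝ) (z : E × (E →L[ℝ] ℝ)) (u : E) :
    energyForm b z (horizontalLift b z u) = 0 := by
  rw [energyForm_apply, Dp_horizontalLift, zero_apply]

theorem energyForm_verticalLift (b : E → E →L[ℝ] E →L[ℝ] ℝ) (z : E × (E →L[ℝ] ℝ))
    (α : E →L[ℝ] ℝ) : energyForm b z (verticalLift E α) = α (sharp b z.1 z.2) := by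
  rw [energyForm_apply, Dp_verticalLift]

namespace IsRiemannianOn

variable {U : Set E} {b : E → E →L[ℝ] E →L[ℝ] ℝ} {z : E × (E →L[ℝ] ℝ)} [FiniteDimensional ℝ E]

omit [FiniteDimensional ℝ E] in
theorem isOpen_prod (hb : IsRiemannianOn U b) :
    IsOpen (U ×ˢ Set.univ : Set (E × (E →L[ℝ] ℝ))) := hb.isOpen.prod isOpen_univ

theorem energy_nonneg (hb : IsRiemannianOn U b) (hz : z.1 ∈ U) : 0 ≤ energy b z := by
  have h : z.2 (sharp b z.1 z.2) = b z.1 (sharp b z.1 z.2) (sharp b z.1 z.2) := by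
    rw [hb.apply_sharp_eq hz]
  rw [energy, h]
  rcases eq_or_ne (sharp b z.1 z.2) 0 with h₀ | h₀
  · simp [h₀]
  · linarith [hb.pos z.1 hz _ h₀]

theorem contDiffOn_sharp_apply (hb : IsRiemannianOn U b) :
    ContDiffOn ℝ ∞ (fun w : E × (E →L[ℝ] ℝ) => sharp b w.1 w.2) (U ×ˢ Set.univ) :=
  (hb.contDiffOn_sharp.comp contDiffOn_fst fun _ hw => hw.1).clm_apply contDiffOn_snd

theorem contDiffOn_energy (hb : IsRiemannianOn U b) :
    ContDiffOn ℝ ∞ (energy b) (U ×ˢ Set.univ) :=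
  contDiffOn_const.mul (contDiffOn_snd.clm_apply hb.contDiffOn_sharp_apply)

theorem hasFDerivAt_energy (hb : IsRiemannianOn U b) (hz : z.1 ∈ U) :
    HasFDerivAt (energy b) (energyForm b z) z := by
  have hzU : z ∈ (U ×ˢ Set.univ : Set (E × (E →L[ℝ] ℝ))) := ⟨hz, trivial⟩
  have hs := ((hb.contDiffOn_sharp_apply.contDiffAt (hb.isOpen_prod.mem_nhds hzU)).differentiableAt
    (by simp)).hasFDerivAt
  set S := fderiv ℝ (fun w : E × (E →L[ℝ] ℝ) => sharp b w.1 w.2) z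
  have hfst : HasFDerivAt (fun w : E × (E →L[ℝ] ℝ) => w.1) (ContinuousLinearMap.fst ℝ _ _) z :=
    hasFDerivAt_fst
  have hsnd : HasFDerivAt (fun w : E × (E →L[ℝ] ℝ) => w.2) (ContinuousLinearMap.snd ℝ _ _) z :=
    hasFDerivAt_snd
  have hB := (hb.differentiableAt hz).hasFDerivAt.comp z hfst
  have h₁ := hB.clm_apply hs
  have h₂ := hsnd.congr_of_eventuallyEq
    (f₁ := fun w : E × (E →L[ℝ] ℝ) => b w.1 (sharp b w.1 w.2)) (by
      filter_upwards [hb.isOpen_prod.mem_nhds hzU] with w hw using hb.apply_sharp hw.1 w.2)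
  have h₃ := (hsnd.clm_apply hs).const_mul (1 / 2 : ℝ)
  refine h₃.congr_fderiv (ContinuousLinearMap.ext fun X => ?_)
  -- Differentiating `g(♯p) = p` and evaluating at `♯p` gives `p(S X)` without a formula for the
  -- derivative of the inverse.
  have h₄ := DFunLike.congr_fun (DFunLike.congr_fun (h₁.unique h₂) X) (sharp b z.1 z.2)
  simp at h₄
  rw [hb.fderiv_metric hz, hb.apply_sharp_eq hz, hb.apply_sharp_eq hz,
    hb.apply_sharp hz] at h₄
  simp [energyForm_apply, Dp_apply]
  linarith

variable {f : ℝ → ℝ}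

theorem contDiffOn_comp_energy (hb : IsRiemannianOn U b) (hf : ContDiffOn ℝ ∞ f (Set.Ici 0)) :
    ContDiffOn ℝ ∞ (fun w => f (energy b w)) (U ×ˢ Set.univ) :=
  hf.comp hb.contDiffOn_energy fun _ hw => hb.energy_nonneg hw.1

theorem hasFDerivAt_comp_energy (hb : IsRiemannianOn U b) (hz : z.1 ∈ U)
    (hf : ContDiffOn ℝ ∞ f (Set.Ici 0)) :
    HasFDerivAt (fun w => f (energy b w)) (deriv₀ f (energy b z) • energyForm b z) z := by
  have ht := hb.energy_nonneg hz
  -- The one-sided derivative suffices, even on the zero section, because nearby energies are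
  -- nonnegative.
  have h₁ : HasDerivWithinAt f (deriv₀ f (energy b z)) (Set.Ici 0) (energy b z) :=
    ((hf.differentiableOn (by simp)) _ ht).hasDerivWithinAt
  refine h₁.comp_hasFDerivAt z (hb.hasFDerivAt_energy hz) ?_
  filter_upwards [hb.isOpen_prod.mem_nhds (show z ∈ U ×ˢ Set.univ from ⟨hz, trivial⟩)] with w hw
    using hb.energy_nonneg hw.1

theorem contDiffOn_lowerTensor {h : ℝ → ℝ} (hb : IsRiemannianOn U b)
    (hf : ContDiffOn ℝ ∞ f (Set.Ici 0)) (hh : ContDiffOn ℝ ∞ h (Set.Ici 0)) :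
    ContDiffOn ℝ ∞ (lowerTensor b f h) (U ×ˢ Set.univ) := by
  have hB : ContDiffOn ℝ ∞ (fun w : E × (E →L[ℝ] ℝ) => b w.1) (U ×ˢ Set.univ) :=
    hb.contDiffOn.comp contDiffOn_fst fun _ hw => hw.1
  rw [contDiffOn_clm_apply]
  intro u
  have hp : ContDiffOn ℝ ∞ (fun w : E × (E →L[ℝ] ℝ) => w.2 u) (U ×ˢ Set.univ) :=
    contDiffOn_snd.clm_apply contDiffOn_const
  exact ((hb.contDiffOn_comp_energy hf).smul (hB.clm_apply contDiffOn_const)).add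
    ((hb.contDiffOn_comp_energy hh).smul (hp.smul contDiffOn_snd))

theorem contDiffOn_upperTensor {h : ℝ → ℝ} (hb : IsRiemannianOn U b)
    (hf : ContDiffOn ℝ ∞ f (Set.Ici 0)) (hh : ContDiffOn ℝ ∞ h (Set.Ici 0)) :
    ContDiffOn ℝ ∞ (upperTensor b f h) (U ×ˢ Set.univ) := by
  have hS : ContDiffOn ℝ ∞ (fun w : E × (E →L[ℝ] ℝ) => sharp b w.1) (U ×ˢ Set.univ) :=
    hb.contDiffOn_sharp.comp contDiffOn_fst fun _ hw => hw.1
  rw [contDiffOn_clm_apply]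
  intro α
  exact ((hb.contDiffOn_comp_energy hf).smul (hS.clm_apply contDiffOn_const)).add
    ((hb.contDiffOn_comp_energy hh).smul
      ((contDiffOn_const.clm_apply hb.contDiffOn_sharp_apply).smul hb.contDiffOn_sharp_apply))

theorem contDiffOn_horizontalLift (hb : IsRiemannianOn U b) :
    ContDiffOn ℝ ∞ (horizontalLift b) (U ×ˢ Set.univ) := by
  have hΓ : ContDiffOn ℝ ∞ (fun w : E × (E →L[ℝ] ℝ) => christoffel b w.1) (U ×ˢ Set.univ) :=
    hb.contDiffOn_christoffel.comp contDiffOn_fst fun _ hw => hw.1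
  rw [contDiffOn_clm_apply]
  intro u
  exact contDiffOn_const.prodMk (contDiffOn_snd.clm_comp (hΓ.clm_apply contDiffOn_const))

theorem contDiffOn_Dp (hb : IsRiemannianOn U b) : ContDiffOn ℝ ∞ (Dp b) (U ×ˢ Set.univ) := by
  have hΓ : ContDiffOn ℝ ∞ (fun w : E × (E →L[ℝ] ℝ) => christoffel b w.1) (U ×ˢ Set.univ) :=
    hb.contDiffOn_christoffel.comp contDiffOn_fst fun _ hw => hw.1
  rw [contDiffOn_clm_apply]
  intro X
  exact contDiffOn_const.sub (contDiffOn_snd.clm_comp (hΓ.clm_apply contDiffOn_const))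

theorem contDiffOn_diagonalJ {a₁ b₁ a₂ b₂ : ℝ → ℝ} (hb : IsRiemannianOn U b)
    (ha₁ : ContDiffOn ℝ ∞ a₁ (Set.Ici 0)) (hb₁ : ContDiffOn ℝ ∞ b₁ (Set.Ici 0))
    (ha₂ : ContDiffOn ℝ ∞ a₂ (Set.Ici 0)) (hb₂ : ContDiffOn ℝ ∞ b₂ (Set.Ici 0)) :
    ContDiffOn ℝ ∞ (diagonalJ b a₁ b₁ a₂ b₂) (U ×ˢ Set.univ) :=
  (contDiffOn_const.clm_comp
      ((hb.contDiffOn_lowerTensor ha₁ hb₁).clm_comp contDiffOn_const)).sub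
    (hb.contDiffOn_horizontalLift.clm_comp
      ((hb.contDiffOn_upperTensor ha₂ hb₂).clm_comp hb.contDiffOn_Dp))

theorem contDiffOn_diagonalG {c₁ d₁ c₂ d₂ : ℝ → ℝ} (hb : IsRiemannianOn U b)
    (hc₁ : ContDiffOn ℝ ∞ c₁ (Set.Ici 0)) (hd₁ : ContDiffOn ℝ ∞ d₁ (Set.Ici 0))
    (hc₂ : ContDiffOn ℝ ∞ c₂ (Set.Ici 0)) (hd₂ : ContDiffOn ℝ ∞ d₂ (Set.Ici 0)) :
    ContDiffOn ℝ ∞ (diagonalG b c₁ d₁ c₂ d₂) (U ×ˢ Set.univ) := by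
  rw [contDiffOn_clm_apply]
  intro X
  rw [contDiffOn_clm_apply]
  intro Y
  have hX := hb.contDiffOn_Dp.clm_apply (contDiffOn_const (c := X))
  have hY := hb.contDiffOn_Dp.clm_apply (contDiffOn_const (c := Y))
  exact (((hb.contDiffOn_lowerTensor hc₁ hd₁).clm_apply (contDiffOn_const (c := X.1))).clm_apply
      (contDiffOn_const (c := Y.1))).add
    (hX.clm_apply ((hb.contDiffOn_upperTensor hc₂ hd₂).clm_apply hY))

end IsRiemannianOn

end Energy

/-! ### Tensoriality of the Nijenhuis tensor -/

section Nijenhuis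

variable {F : Type*} [NormedAddCommGroup F] [NormedSpace ℝ F] {Ω : Set F} {J : F → F →L[ℝ] F}
  {z : F}

/-- The pointwise expression of the Nijenhuis tensor in terms of the derivative of `J`. -/
def nijenhuisForm (J : F → F →L[ℝ] F) (z u v : F) : F :=
  fderiv ℝ J z (J z u) v - fderiv ℝ J z (J z v) u
    + J z (fderiv ℝ J z v u) - J z (fderiv ℝ J z u v)

/-- The derivatives of `X` and `Y` cancel because `J² = -1`, so only their values at `z` matter. -/
theorem nijenhuis_eq_nijenhuisForm (hJ : DifferentiableAt ℝ J z)
    (hsq : ∀ u, J z (J z u) = -u) {X Y : F → F} (hX : DifferentiableAt ℝ X z)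
    (hY : DifferentiableAt ℝ Y z) :
    nijenhuis J X Y z = nijenhuisForm J z (X z) (Y z) := by
  simp only [nijenhuis, nijenhuisForm, VectorField.lieBracket,
    (hJ.hasFDerivAt.clm_apply hX.hasFDerivAt).fderiv,
    (hJ.hasFDerivAt.clm_apply hY.hasFDerivAt).fderiv]
  simp [hsq]
  abel

/-- The derivative of `J² = -1`: each directional derivative of `J` anticommutes with `J`. -/
theorem fderiv_comp_add_comp_fderiv (hΩ : IsOpen Ω) (hz : z ∈ Ω) (hJ : DifferentiableAt ℝ J z)
    (hsq : ∀ w ∈ Ω, ∀ u, J w (J w u) = -u) (u v : F) :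
    fderiv ℝ J z u (J z v) = -J z (fderiv ℝ J z u v) := by
  have h₁ := hJ.hasFDerivAt.clm_apply (hJ.hasFDerivAt.clm_apply (hasFDerivAt_const v z))
  have h₂ := (hasFDerivAt_const (𝕜 := ℝ) (-v) z).congr_of_eventuallyEq (f₁ := fun w => J w (J w v)) (by
    filter_upwards [hΩ.mem_nhds hz] with w hw using hsq w hw v)
  have := DFunLike.congr_fun (h₁.unique h₂) u
  simp at this
  rw [eq_neg_iff_add_eq_zero, ← this, add_comm]

/-- Since `N(J u, v) = -J N(u, v)` and `N` is skew, `N` vanishes if it vanishes on a set `H` such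
that `H + J H` is the whole space. -/
theorem nijenhuisForm_eq_zero (hΩ : IsOpen Ω) (hz : z ∈ Ω) (hJ : DifferentiableAt ℝ J z)
    (hsq : ∀ w ∈ Ω, ∀ u, J w (J w u) = -u) {H : Set F}
    (hH : ∀ u, ∃ v ∈ H, ∃ w ∈ H, u = v + J z w)
    (hN : ∀ u ∈ H, ∀ v ∈ H, nijenhuisForm J z u v = 0) (u v : F) :
    nijenhuisForm J z u v = 0 := by
  have hc := fderiv_comp_add_comp_fderiv hΩ hz hJ hsq
  have swap : ∀ u v, nijenhuisForm J z v u = -nijenhuisForm J z u v := by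
    intro u v
    simp only [nijenhuisForm]
    abel
  have left : ∀ u v, nijenhuisForm J z (J z u) v = -J z (nijenhuisForm J z u v) := by
    intro u v
    simp only [nijenhuisForm, hc, hsq z hz, map_add, map_sub, map_neg, _root_.neg_apply]
    abel
  have add : ∀ u u' v, nijenhuisForm J z (u + u') v
      = nijenhuisForm J z u v + nijenhuisForm J z u' v := by
    intro u u' v
    simp only [nijenhuisForm, map_add, _root_.add_apply]
    abel
  have h₁ : ∀ u, ∀ v ∈ H, nijenhuisForm J z u v = 0 := by
    intro u v hv
    obtain ⟨a, ha, a', ha', rfl⟩ := hH u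
    rw [add, left, hN a ha v hv, hN a' ha' v hv]
    simp
  obtain ⟨a, ha, a', ha', rfl⟩ := hH v
  rw [swap, add, left, swap, swap _ a', h₁ u a ha, h₁ u a' ha']
  simp

end Nijenhuis

/-! ### Integrability of the diagonal almost complex structure -/

section Integrability

variable {E : Type*} [NormedAddCommGroup E] [NormedSpace ℝ E]

theorem diagonalJ_horizontalLift (b : E → E →L[ℝ] E →L[ℝ] ℝ) (a₁ b₁ a₂ b₂ : ℝ → ℝ)
    (z : E × (E →L[ℝ] ℝ)) (u : E) :
    diagonalJ b a₁ b₁ a₂ b₂ z (horizontalLift b z u)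
      = verticalLift E (lowerTensor b a₁ b₁ z u) := by
  rw [diagonalJ_apply, Dp_horizontalLift, horizontalLift_fst]
  simp

theorem Dp_diagonalJ (b : E → E →L[ℝ] E →L[ℝ] ℝ) (a₁ b₁ a₂ b₂ : ℝ → ℝ)
    (z X : E × (E →L[ℝ] ℝ)) :
    Dp b z (diagonalJ b a₁ b₁ a₂ b₂ z X) = lowerTensor b a₁ b₁ z X.1 := by
  rw [diagonalJ_apply, map_sub, Dp_verticalLift, Dp_horizontalLift, sub_zero]

theorem diagonalJ_fst (b : E → E →L[ℝ] E →L[ℝ] ℝ) (a₁ b₁ a₂ b₂ : ℝ → ℝ)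
    (z X : E × (E →L[ℝ] ℝ)) :
    (diagonalJ b a₁ b₁ a₂ b₂ z X).1 = -upperTensor b a₂ b₂ z (Dp b z X) := by
  rw [diagonalJ_apply, Prod.fst_sub, horizontalLift_fst]
  simp [verticalLift]

namespace IsRiemannianOn

variable {U : Set E} {b : E → E →L[ℝ] E →L[ℝ] ℝ} {z : E × (E →L[ℝ] ℝ)} [FiniteDimensional ℝ E]

/-- The hypotheses compare the coefficients of the identity and of the rank-one part in the
composite. -/
theorem upperTensor_lowerTensor {a₁ b₁ a₂ b₂ : ℝ → ℝ} (hb : IsRiemannianOn U b) (hz : z.1 ∈ U)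
    (h₁ : a₁ (energy b z) * a₂ (energy b z) = 1)
    (h₂ : a₂ (energy b z) * b₁ (energy b z)
      + b₂ (energy b z) * (a₁ (energy b z) + 2 * energy b z * b₁ (energy b z)) = 0) (u : E) :
    upperTensor b a₂ b₂ z (lowerTensor b a₁ b₁ z u) = u := by
  refine hb.ext_of_metric hz fun v => ?_
  rw [upperTensor_apply, lowerTensor_apply, hb.apply_sharp_eq hz]
  simp only [map_add, map_smul, _root_.add_apply, _root_.smul_apply, hb.apply_sharp hz,
    lowerTensor_apply, smul_eq_mul, apply_sharp_self]
  linear_combination b z.1 u v * h₁ + z.2 u * z.2 v * h₂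

theorem lowerTensor_upperTensor {a₁ b₁ a₂ b₂ : ℝ → ℝ} (hb : IsRiemannianOn U b) (hz : z.1 ∈ U)
    (h₁ : a₁ (energy b z) * a₂ (energy b z) = 1)
    (h₂ : a₁ (energy b z) * b₂ (energy b z)
      + b₁ (energy b z) * (a₂ (energy b z) + 2 * energy b z * b₂ (energy b z)) = 0)
    (α : E →L[ℝ] ℝ) :
    lowerTensor b a₁ b₁ z (upperTensor b a₂ b₂ z α) = α := by
  ext v
  rw [lowerTensor_apply, upperTensor_apply]
  simp only [map_add, map_smul, _root_.add_apply, _root_.smul_apply, hb.apply_sharp hz,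
    smul_eq_mul, apply_sharp_self, hb.sharp_symm hz z.2 α]
  linear_combination α v * h₁ + α (sharp b z.1 z.2) * z.2 v * h₂

theorem diagonalJ_diagonalJ {a₁ b₁ a₂ b₂ : ℝ → ℝ} (hb : IsRiemannianOn U b) (hz : z.1 ∈ U)
    (h₁ : a₁ (energy b z) * a₂ (energy b z) = 1)
    (h₂ : a₂ (energy b z) * b₁ (energy b z)
      + b₂ (energy b z) * (a₁ (energy b z) + 2 * energy b z * b₁ (energy b z)) = 0)
    (h₃ : a₁ (energy b z) * b₂ (energy b z)
      + b₁ (energy b z) * (a₂ (energy b z) + 2 * energy b z * b₂ (energy b z)) = 0)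
    (X : E × (E →L[ℝ] ℝ)) :
    diagonalJ b a₁ b₁ a₂ b₂ z (diagonalJ b a₁ b₁ a₂ b₂ z X) = -X := by
  conv_rhs => rw [← horizontalLift_add_verticalLift b z X]
  rw [diagonalJ_apply _ _ _ _ _ _ (diagonalJ b a₁ b₁ a₂ b₂ z X), Dp_diagonalJ, diagonalJ_fst,
    map_neg, hb.upperTensor_lowerTensor hz h₁ h₂, hb.lowerTensor_upperTensor hz h₁ h₃, map_neg]
  abel

theorem hasFDerivAt_horizontalLift (hb : IsRiemannianOn U b) (hz : z.1 ∈ U) (v : E) :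
    ∃ D : E × (E →L[ℝ] ℝ) →L[ℝ] E × (E →L[ℝ] ℝ),
      HasFDerivAt (fun w => horizontalLift b w v) D z ∧
      ∀ X, D X = verticalLift E (X.2 ∘L christoffel b z.1 v
        + z.2 ∘L fderiv ℝ (christoffel b) z.1 X.1 v) := by
  have hΓ := (hb.differentiableAt_christoffel hz).hasFDerivAt.comp z
    (hasFDerivAt_fst (𝕜 := ℝ) (E := E) (F := E →L[ℝ] ℝ))
  have h := (hasFDerivAt_const (𝕜 := ℝ) v z).prodMk
    ((hasFDerivAt_snd (𝕜 := ℝ) (E := E) (F := E →L[ℝ] ℝ)).clm_comp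
      (hΓ.clm_apply (hasFDerivAt_const v z)))
  refine ⟨_, h, fun X => Prod.ext ?_ ?_⟩
  · simp [verticalLift]
  · ext y
    simp [verticalLift, add_comm]

theorem hasFDerivAt_lowerTensor {f h : ℝ → ℝ} (hb : IsRiemannianOn U b) (hz : z.1 ∈ U)
    (hf : ContDiffOn ℝ ∞ f (Set.Ici 0)) (hh : ContDiffOn ℝ ∞ h (Set.Ici 0)) (v : E) :
    ∃ D : E × (E →L[ℝ] ℝ) →L[ℝ] (E →L[ℝ] ℝ),
      HasFDerivAt (fun w => lowerTensor b f h w v) D z ∧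
      ∀ X y, D X y = deriv₀ f (energy b z) * energyForm b z X * b z.1 v y
        + f (energy b z) * fderiv ℝ b z.1 X.1 v y
        + deriv₀ h (energy b z) * energyForm b z X * (z.2 v * z.2 y)
        + h (energy b z) * (X.2 v * z.2 y + z.2 v * X.2 y) := by
  have hB := (hb.differentiableAt hz).hasFDerivAt.comp z
    (hasFDerivAt_fst (𝕜 := ℝ) (E := E) (F := E →L[ℝ] ℝ))
  have hp := hasFDerivAt_snd (𝕜 := ℝ) (E := E) (F := E →L[ℝ] ℝ) (p := z)
  have hv := hasFDerivAt_const (𝕜 := ℝ) v z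
  have h := ((hb.hasFDerivAt_comp_energy hz hf).smul (hB.clm_apply hv)).add
    ((hb.hasFDerivAt_comp_energy hz hh).smul ((hp.clm_apply hv).smul hp))
  refine ⟨_, h, fun X y => ?_⟩
  simp
  ring

variable {a₁ b₁ : ℝ → ℝ}

/-- The covector is `p ∘ R(u, v)`: curvature measures the failure of the horizontal distribution to
be involutive. -/
theorem lieBracket_horizontalLift (hb : IsRiemannianOn U b) (hz : z.1 ∈ U) (u v : E) :
    VectorField.lieBracket ℝ (fun w => horizontalLift b w u) (fun w => horizontalLift b w v) z
      = verticalLift E (z.2 ∘L (fderiv ℝ (christoffel b) z.1 u v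
        - fderiv ℝ (christoffel b) z.1 v u
        + christoffel b z.1 u ∘L christoffel b z.1 v
        - christoffel b z.1 v ∘L christoffel b z.1 u)) := by
  obtain ⟨Du, hDu, hu⟩ := hb.hasFDerivAt_horizontalLift hz u
  obtain ⟨Dv, hDv, hv⟩ := hb.hasFDerivAt_horizontalLift hz v
  rw [VectorField.lieBracket, hDu.fderiv, hDv.fderiv, hu, hv, ← map_sub]
  congr 1
  ext y
  simp [horizontalLift_fst, horizontalLift_snd]
  ring

/-- Horizontally `t` is constant and both `g` and `p` are parallel, so only the Christoffel term
remains. It is symmetric in `u, v`, which makes the mixed brackets cancel in the Nijenhuis tensor.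
-/
theorem lieBracket_horizontal_vertical (hb : IsRiemannianOn U b) (hz : z.1 ∈ U)
    (ha₁ : ContDiffOn ℝ ∞ a₁ (Set.Ici 0)) (hb₁ : ContDiffOn ℝ ∞ b₁ (Set.Ici 0)) (u v : E) :
    VectorField.lieBracket ℝ (fun w => horizontalLift b w u)
        (fun w => verticalLift E (lowerTensor b a₁ b₁ w v)) z
      = verticalLift E (lowerTensor b a₁ b₁ z (christoffel b z.1 u v)) := by
  obtain ⟨Du, hDu, hu⟩ := hb.hasFDerivAt_horizontalLift hz u
  obtain ⟨Dv, hDv, hv⟩ := hb.hasFDerivAt_lowerTensor hz ha₁ hb₁ v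
  have hDv' := (verticalLift E).hasFDerivAt.comp z hDv
  rw [VectorField.lieBracket, hDu.fderiv]
  erw [hDv'.fderiv]
  rw [ContinuousLinearMap.comp_apply, hu, ← map_sub]
  congr 1
  ext y
  rw [_root_.sub_apply, hv, energyForm_horizontalLift]
  simp [horizontalLift_fst, horizontalLift_snd, verticalLift, lowerTensor_apply,
    hb.fderiv_metric hz]
  ring

/-- A computation in one fibre: `dt` takes the value `(a₁ + 2 t b₁) p(u)` on the lift of the
`u`-covector, and the terms in `b₁'` are symmetric in `u, v`, hence drop out. -/
theorem lieBracket_vertical (hb : IsRiemannianOn U b) (hz : z.1 ∈ U)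
    (ha₁ : ContDiffOn ℝ ∞ a₁ (Set.Ici 0)) (hb₁ : ContDiffOn ℝ ∞ b₁ (Set.Ici 0)) (u v : E) :
    VectorField.lieBracket ℝ (fun w => verticalLift E (lowerTensor b a₁ b₁ w u))
        (fun w => verticalLift E (lowerTensor b a₁ b₁ w v)) z
      = verticalLift E ((deriv₀ a₁ (energy b z)
            * (a₁ (energy b z) + 2 * energy b z * b₁ (energy b z))
          - a₁ (energy b z) * b₁ (energy b z)) • (z.2 u • b z.1 v - z.2 v • b z.1 u)) := by
  obtain ⟨Du, hDu, hu⟩ := hb.hasFDerivAt_lowerTensor hz ha₁ hb₁ u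
  obtain ⟨Dv, hDv, hv⟩ := hb.hasFDerivAt_lowerTensor hz ha₁ hb₁ v
  have hDu' := (verticalLift E).hasFDerivAt.comp z hDu
  have hDv' := (verticalLift E).hasFDerivAt.comp z hDv
  rw [VectorField.lieBracket]
  erw [hDu'.fderiv, hDv'.fderiv]
  rw [ContinuousLinearMap.comp_apply, ContinuousLinearMap.comp_apply, ← map_sub]
  congr 1
  ext y
  rw [_root_.sub_apply, hv, hu, energyForm_verticalLift, energyForm_verticalLift,
    lowerTensor_apply, lowerTensor_apply, hb.apply_sharp_eq hz, hb.apply_sharp_eq hz,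
    apply_sharp_self]
  simp [verticalLift, lowerTensor_apply, hb.symm z.1 hz v u]
  ring

/-- On a space of constant sectional curvature `c`, the natural almost complex structure of
diagonal type is integrable if `a₁' (a₁ + 2 t b₁) - a₁ b₁ = c`. -/
theorem nijenhuis_diagonalJ_eq_zero {a₂ b₂ : ℝ → ℝ} {c : ℝ} (hb : IsRiemannianOn U b)
    (hc : ∀ x ∈ U, ∀ u v : E,
      b x (curvature b x u v v) u = c * (b x u u * b x v v - b x u v ^ 2))
    (ha₁ : ContDiffOn ℝ ∞ a₁ (Set.Ici 0)) (hb₁ : ContDiffOn ℝ ∞ b₁ (Set.Ici 0))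
    (ha₂ : ContDiffOn ℝ ∞ a₂ (Set.Ici 0)) (hb₂ : ContDiffOn ℝ ∞ b₂ (Set.Ici 0))
    (h₁ : ∀ t, 0 ≤ t → a₁ t * a₂ t = 1)
    (h₂ : ∀ t, 0 ≤ t → a₂ t * b₁ t + b₂ t * (a₁ t + 2 * t * b₁ t) = 0)
    (h₃ : ∀ t, 0 ≤ t → a₁ t * b₂ t + b₁ t * (a₂ t + 2 * t * b₂ t) = 0)
    (h₄ : ∀ t, 0 ≤ t → deriv₀ a₁ t * (a₁ t + 2 * t * b₁ t) - a₁ t * b₁ t = c)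
    {X Y : E × (E →L[ℝ] ℝ) → E × (E →L[ℝ] ℝ)} (hz : z.1 ∈ U)
    (hX : DifferentiableAt ℝ X z) (hY : DifferentiableAt ℝ Y z) :
    nijenhuis (diagonalJ b a₁ b₁ a₂ b₂) X Y z = 0 := by
  have hzU : z ∈ (U ×ˢ Set.univ : Set (E × (E →L[ℝ] ℝ))) := ⟨hz, trivial⟩
  have hnhds := hb.isOpen_prod.mem_nhds hzU
  have hJ : DifferentiableAt ℝ (diagonalJ b a₁ b₁ a₂ b₂) z :=
    ((hb.contDiffOn_diagonalJ ha₁ hb₁ ha₂ hb₂).contDiffAt hnhds).differentiableAt (by simp)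
  have hsq : ∀ w ∈ (U ×ˢ Set.univ : Set (E × (E →L[ℝ] ℝ))), ∀ X,
      diagonalJ b a₁ b₁ a₂ b₂ w (diagonalJ b a₁ b₁ a₂ b₂ w X) = -X := fun w hw =>
    hb.diagonalJ_diagonalJ hw.1 (h₁ _ (hb.energy_nonneg hw.1)) (h₂ _ (hb.energy_nonneg hw.1))
      (h₃ _ (hb.energy_nonneg hw.1))
  rw [nijenhuis_eq_nijenhuisForm hJ (hsq z hzU) hX hY]
  refine nijenhuisForm_eq_zero hb.isOpen_prod hzU hJ hsq (H := Set.range (horizontalLift b z))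
    ?_ ?_ _ _
  · intro u
    refine ⟨_, ⟨u.1, rfl⟩, _, ⟨upperTensor b a₂ b₂ z (Dp b z u), rfl⟩, ?_⟩
    rw [diagonalJ_horizontalLift, hb.lowerTensor_upperTensor hz (h₁ _ (hb.energy_nonneg hz))
      (h₃ _ (hb.energy_nonneg hz)), horizontalLift_add_verticalLift]
  · rintro _ ⟨u, rfl⟩ _ ⟨v, rfl⟩
    have hd : ∀ u, DifferentiableAt ℝ (fun w => horizontalLift b w u) z := fun u =>
      let ⟨_, h, _⟩ := hb.hasFDerivAt_horizontalLift hz u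
      h.differentiableAt
    rw [← nijenhuis_eq_nijenhuisForm hJ (hsq z hzU) (hd u) (hd v)]
    simp only [nijenhuis, diagonalJ_horizontalLift]
    rw [hb.lieBracket_vertical hz ha₁ hb₁, hb.lieBracket_horizontal_vertical hz ha₁ hb₁,
      VectorField.lieBracket_swap, hb.lieBracket_horizontal_vertical hz ha₁ hb₁,
      hb.christoffel_symm hz v u, hb.lieBracket_horizontalLift hz,
      h₄ _ (hb.energy_nonneg hz), map_neg, sub_neg_eq_add, add_sub_cancel_right, ← map_sub]
    convert map_zero (verticalLift E)
    ext y
    -- What remains is the vertical bracket, with factor `c`, minus `p ∘ R(u, v)`.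
    have hR := congrArg z.2 (hb.curvature_eq hz (hc z.1 hz) u v y)
    simp only [curvature, map_add, map_sub, map_smul, smul_eq_mul] at hR
    simp
    rw [hR]
    ring

end IsRiemannianOn

end Integrability

/-- Coefficients of a natural structure of diagonal type which is almost Hermitian and which is
integrable over a base of constant sectional curvature `c`; `lam` and `mu` are the
proportionality factors of the metric and the complex structure. -/
structure IsHermitianCoeff (c : ℝ) (lam mu a₁ b₁ a₂ b₂ c₁ d₁ c₂ d₂ : ℝ → ℝ) : Prop where
  lam_smooth : ContDiffOn ℝ ∞ lam (Set.Ici 0)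
  mu_smooth : ContDiffOn ℝ ∞ mu (Set.Ici 0)
  a₁_smooth : ContDiffOn ℝ ∞ a₁ (Set.Ici 0)
  b₁_smooth : ContDiffOn ℝ ∞ b₁ (Set.Ici 0)
  a₂_smooth : ContDiffOn ℝ ∞ a₂ (Set.Ici 0)
  b₂_smooth : ContDiffOn ℝ ∞ b₂ (Set.Ici 0)
  c₁_smooth : ContDiffOn ℝ ∞ c₁ (Set.Ici 0)
  d₁_smooth : ContDiffOn ℝ ∞ d₁ (Set.Ici 0)
  c₂_smooth : ContDiffOn ℝ ∞ c₂ (Set.Ici 0)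
  d₂_smooth : ContDiffOn ℝ ∞ d₂ (Set.Ici 0)
  a₁_mul_a₂ : ∀ t, 0 ≤ t → a₁ t * a₂ t = 1
  upper_lower : ∀ t, 0 ≤ t → a₂ t * b₁ t + b₂ t * (a₁ t + 2 * t * b₁ t) = 0
  lower_upper : ∀ t, 0 ≤ t → a₁ t * b₂ t + b₁ t * (a₂ t + 2 * t * b₂ t) = 0
  integrable : ∀ t, 0 ≤ t → deriv₀ a₁ t * (a₁ t + 2 * t * b₁ t) - a₁ t * b₁ t = c
  c₁_mul_a₂ : ∀ t, 0 ≤ t → c₁ t * a₂ t = lam t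
  c₁_d₁ : ∀ t, 0 ≤ t → c₁ t * b₂ t + d₁ t * (a₂ t + 2 * t * b₂ t) = mu t
  c₂_mul_a₁ : ∀ t, 0 ≤ t → c₂ t * a₁ t = lam t
  c₂_d₂ : ∀ t, 0 ≤ t → c₂ t * b₁ t + d₂ t * (a₁ t + 2 * t * b₁ t) = mu t
  c₁_pos : ∀ t, 0 ≤ t → 0 < c₁ t
  c₁_d₁_pos : ∀ t, 0 ≤ t → 0 < c₁ t + 2 * t * d₁ t
  c₂_pos : ∀ t, 0 ≤ t → 0 < c₂ t
  c₂_d₂_pos : ∀ t, 0 ≤ t → 0 < c₂ t + 2 * t * d₂ t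

/-! ### Positivity, the fundamental form and its exterior derivative -/

section Kahler

variable {E : Type*} [NormedAddCommGroup E] [NormedSpace ℝ E] [FiniteDimensional ℝ E]
  {U : Set E} {b : E → E →L[ℝ] E →L[ℝ] ℝ} {z : E × (E →L[ℝ] ℝ)} {c : ℝ}
  {lam mu a₁ b₁ a₂ b₂ c₁ d₁ c₂ d₂ : ℝ → ℝ}

namespace IsRiemannianOn

/-- The Cauchy–Schwarz inequality `p(v)² ≤ 2 t g(v, v)`. -/
theorem sq_apply_le (hb : IsRiemannianOn U b) (hz : z.1 ∈ U) (v : E) :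
    z.2 v ^ 2 ≤ 2 * energy b z * b z.1 v v := by
  rcases eq_or_ne v 0 with rfl | hv
  · simp
  have hpos := hb.pos z.1 hz v hv
  -- This vector is `g(v, v)` times the component of `♯p` orthogonal to `v`; its squared norm is
  -- `g(v, v) (2 t g(v, v) - p(v)²)`.
  have hnn : 0 ≤ b z.1 (b z.1 v v • sharp b z.1 z.2 - z.2 v • v)
      (b z.1 v v • sharp b z.1 z.2 - z.2 v • v) := by
    rcases eq_or_ne (b z.1 v v • sharp b z.1 z.2 - z.2 v • v) 0 with h | h
    · simp [h]
    · exact (hb.pos z.1 hz _ h).le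
  simp only [map_sub, map_smul, _root_.sub_apply, _root_.smul_apply, smul_eq_mul,
    hb.apply_sharp hz, hb.apply_sharp_eq hz, apply_sharp_self] at hnn
  have : 0 ≤ b z.1 v v * (2 * energy b z * b z.1 v v - z.2 v ^ 2) := by linarith
  linarith [nonneg_of_mul_nonneg_right this hpos]

/-- Relative to `g` the eigenvalues are `f` on `ker p` and `f + 2 t h` along `♯p`. Cauchy–Schwarz is
needed only for `h ≤ 0`. -/
theorem lowerTensor_pos {f h : ℝ → ℝ} (hb : IsRiemannianOn U b) (hz : z.1 ∈ U)
    (hf : 0 < f (energy b z)) (hfh : 0 < f (energy b z) + 2 * energy b z * h (energy b z))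
    {v : E} (hv : v ≠ 0) : 0 < lowerTensor b f h z v v := by
  have hpos := hb.pos z.1 hz v hv
  have hcs := hb.sq_apply_le hz v
  rw [lowerTensor_apply]
  rcases le_total 0 (h (energy b z)) with hh | hh
  · have := mul_nonneg hh (mul_self_nonneg (z.2 v))
    have := mul_pos hf hpos
    linarith
  · have h₁ := mul_nonneg (neg_nonneg.2 hh) (sub_nonneg.2 hcs)
    have h₂ := mul_pos hfh hpos
    nlinarith

/-- Transports symmetry and positivity from the lower to the upper tensor. -/
theorem apply_upperTensor {f h : ℝ → ℝ} (hb : IsRiemannianOn U b) (hz : z.1 ∈ U)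
    (α β : E →L[ℝ] ℝ) :
    α (upperTensor b f h z β) = lowerTensor b f h z (sharp b z.1 α) (sharp b z.1 β) := by
  rw [upperTensor_apply, lowerTensor_apply, hb.apply_sharp hz, hb.sharp_symm hz z.2 α,
    hb.sharp_symm hz z.2 β]
  simp only [map_add, map_smul, smul_eq_mul]
  ring

omit [FiniteDimensional ℝ E] in
theorem lowerTensor_symm {f h : ℝ → ℝ} (hb : IsRiemannianOn U b) (hz : z.1 ∈ U) (u v : E) :
    lowerTensor b f h z u v = lowerTensor b f h z v u := by
  rw [lowerTensor_apply, lowerTensor_apply, hb.symm z.1 hz u v, mul_comm (z.2 u)]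

theorem diagonalG_symm (hb : IsRiemannianOn U b) (hz : z.1 ∈ U) (X Y : E × (E →L[ℝ] ℝ)) :
    diagonalG b c₁ d₁ c₂ d₂ z X Y = diagonalG b c₁ d₁ c₂ d₂ z Y X := by
  rw [diagonalG_apply, diagonalG_apply, hb.apply_upperTensor hz, hb.apply_upperTensor hz,
    hb.lowerTensor_symm hz X.1, hb.lowerTensor_symm hz (sharp b z.1 (Dp b z X))]

theorem diagonalG_pos (hb : IsRiemannianOn U b) (hz : z.1 ∈ U)
    (hc₁ : 0 < c₁ (energy b z)) (hd₁ : 0 < c₁ (energy b z) + 2 * energy b z * d₁ (energy b z))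
    (hc₂ : 0 < c₂ (energy b z)) (hd₂ : 0 < c₂ (energy b z) + 2 * energy b z * d₂ (energy b z))
    {X : E × (E →L[ℝ] ℝ)} (hX : X ≠ 0) : 0 < diagonalG b c₁ d₁ c₂ d₂ z X X := by
  rw [diagonalG_apply, hb.apply_upperTensor hz]
  rcases eq_or_ne X.1 0 with h₁ | h₁
  · have h₂ : sharp b z.1 (Dp b z X) ≠ 0 := by
      intro h
      apply hX
      rw [← horizontalLift_add_verticalLift b z X, ← hb.apply_sharp hz (Dp b z X), h, h₁]
      simp
    rw [h₁, map_zero, zero_add]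
    exact hb.lowerTensor_pos hz hc₂ hd₂ h₂
  · have h₂ : 0 ≤ lowerTensor b c₂ d₂ z (sharp b z.1 (Dp b z X)) (sharp b z.1 (Dp b z X)) := by
      rcases eq_or_ne (sharp b z.1 (Dp b z X)) 0 with h | h
      · simp [h]
      · exact (hb.lowerTensor_pos hz hc₂ hd₂ h).le
    have := hb.lowerTensor_pos hz hc₁ hd₁ h₁
    linarith

/-- The fundamental form is `λ dp_i ∧ dq^i + μ dt ∧ p_i dq^i`. -/
theorem fundamentalForm_eq (hb : IsRiemannianOn U b)
    (hk : IsHermitianCoeff c lam mu a₁ b₁ a₂ b₂ c₁ d₁ c₂ d₂) (hz : z.1 ∈ U)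
    (Y Z : E × (E →L[ℝ] ℝ)) :
    fundamentalForm (diagonalG b c₁ d₁ c₂ d₂) (diagonalJ b a₁ b₁ a₂ b₂) z Y Z
      = lam (energy b z) * (Y.2 Z.1 - Z.2 Y.1)
        + mu (energy b z) * (energyForm b z Y * z.2 Z.1 - energyForm b z Z * z.2 Y.1) := by
  have ht := hb.energy_nonneg hz
  rw [fundamentalForm, diagonalG_apply, Dp_diagonalJ, diagonalJ_fst, energyForm_apply,
    energyForm_apply, map_neg]
  have h₁ : lowerTensor b c₁ d₁ z Y.1 (upperTensor b a₂ b₂ z (Dp b z Z))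
      = lam (energy b z) * Dp b z Z Y.1
        + mu (energy b z) * (Dp b z Z (sharp b z.1 z.2) * z.2 Y.1) := by
    rw [lowerTensor_apply, upperTensor_apply]
    simp only [map_add, map_smul, smul_eq_mul, hb.apply_sharp_eq hz, apply_sharp_self,
      hb.sharp_symm hz z.2 (Dp b z Z)]
    linear_combination Dp b z Z Y.1 * hk.c₁_mul_a₂ _ ht
      + Dp b z Z (sharp b z.1 z.2) * z.2 Y.1 * hk.c₁_d₁ _ ht
  have h₂ : Dp b z Y (upperTensor b c₂ d₂ z (lowerTensor b a₁ b₁ z Z.1))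
      = lam (energy b z) * Dp b z Y Z.1
        + mu (energy b z) * (Dp b z Y (sharp b z.1 z.2) * z.2 Z.1) := by
    rw [upperTensor_apply, lowerTensor_apply]
    simp only [map_add, map_smul, smul_eq_mul, hb.apply_sharp_eq hz, apply_sharp_self,
      hb.sharp_symm hz (Dp b z Y) (lowerTensor b a₁ b₁ z Z.1)]
    rw [lowerTensor_apply, ← hb.apply_sharp_eq hz (Dp b z Y) Z.1,
      hb.sharp_symm hz (Dp b z Y) z.2]
    linear_combination b z.1 Z.1 (sharp b z.1 (Dp b z Y)) * hk.c₂_mul_a₁ _ ht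
      + z.2 (sharp b z.1 (Dp b z Y)) * z.2 Z.1 * hk.c₂_d₂ _ ht
  -- Torsion-freeness lets `dp` replace `Dp` in the `λ` term.
  rw [h₁, h₂, Dp_apply b z Y Z.1, Dp_apply b z Z Y.1, hb.christoffel_symm hz Y.1 Z.1]
  ring

theorem isHermitianOn (hb : IsRiemannianOn U b)
    (hc : ∀ x ∈ U, ∀ u v : E,
      b x (curvature b x u v v) u = c * (b x u u * b x v v - b x u v ^ 2))
    (hk : IsHermitianCoeff c lam mu a₁ b₁ a₂ b₂ c₁ d₁ c₂ d₂) :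
    IsHermitianOn (U ×ˢ Set.univ) (diagonalG b c₁ d₁ c₂ d₂) (diagonalJ b a₁ b₁ a₂ b₂) := by
  have hsq : ∀ w ∈ (U ×ˢ Set.univ : Set (E × (E →L[ℝ] ℝ))), ∀ X,
      diagonalJ b a₁ b₁ a₂ b₂ w (diagonalJ b a₁ b₁ a₂ b₂ w X) = -X := fun w hw =>
    have ht := hb.energy_nonneg hw.1
    hb.diagonalJ_diagonalJ hw.1 (hk.a₁_mul_a₂ _ ht) (hk.upper_lower _ ht) (hk.lower_upper _ ht)
  refine ⟨hb.contDiffOn_diagonalG hk.c₁_smooth hk.d₁_smooth hk.c₂_smooth hk.d₂_smooth,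
    fun z hz => hb.diagonalG_symm hz.1, fun z hz X hX => ?_,
    hb.contDiffOn_diagonalJ hk.a₁_smooth hk.b₁_smooth hk.a₂_smooth hk.b₂_smooth, hsq, ?_, ?_⟩
  · have ht := hb.energy_nonneg hz.1
    exact hb.diagonalG_pos hz.1 (hk.c₁_pos _ ht) (hk.c₁_d₁_pos _ ht) (hk.c₂_pos _ ht)
      (hk.c₂_d₂_pos _ ht) hX
  · intro X Y hX hY z hz
    have hnhds := hb.isOpen_prod.mem_nhds hz
    exact hb.nijenhuis_diagonalJ_eq_zero hc hk.a₁_smooth hk.b₁_smooth hk.a₂_smooth hk.b₂_smooth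
      hk.a₁_mul_a₂ hk.upper_lower hk.lower_upper hk.integrable hz.1
      ((hX.contDiffAt hnhds).differentiableAt (by simp))
      ((hY.contDiffAt hnhds).differentiableAt (by simp))
  · intro z hz X Y
    -- Compatibility follows from skewness of the explicit `φ`: `G(JX, JY) = φ(JX, Y) = -φ(Y, JX) =
    -- G(Y, X)`.
    have h₁ := hb.fundamentalForm_eq hk hz.1 (diagonalJ b a₁ b₁ a₂ b₂ z X) Y
    have h₂ := hb.fundamentalForm_eq hk hz.1 Y (diagonalJ b a₁ b₁ a₂ b₂ z X)
    have h₃ : fundamentalForm (diagonalG b c₁ d₁ c₂ d₂) (diagonalJ b a₁ b₁ a₂ b₂) z Y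
        (diagonalJ b a₁ b₁ a₂ b₂ z X) = -diagonalG b c₁ d₁ c₂ d₂ z Y X := by
      rw [fundamentalForm, hsq z hz, map_neg]
    have h₄ : diagonalG b c₁ d₁ c₂ d₂ z (diagonalJ b a₁ b₁ a₂ b₂ z X)
        (diagonalJ b a₁ b₁ a₂ b₂ z Y) = _ := h₁
    rw [h₄, hb.diagonalG_symm hz.1 X Y, ← neg_eq_iff_eq_neg.2 h₃, h₂]
    ring

/-- The Hessian of the energy stays unexpanded: it disappears from the cyclic sum by symmetry, which
is `d(dt) = 0`. -/
theorem fderiv_fundamentalForm (hb : IsRiemannianOn U b)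
    (hk : IsHermitianCoeff c lam mu a₁ b₁ a₂ b₂ c₁ d₁ c₂ d₂) (hz : z.1 ∈ U)
    (X Y Z : E × (E →L[ℝ] ℝ)) :
    fderiv ℝ (fun w => fundamentalForm (diagonalG b c₁ d₁ c₂ d₂) (diagonalJ b a₁ b₁ a₂ b₂) w Y Z)
        z X
      = deriv₀ lam (energy b z) * energyForm b z X * (Y.2 Z.1 - Z.2 Y.1)
        + deriv₀ mu (energy b z) * energyForm b z X
          * (energyForm b z Y * z.2 Z.1 - energyForm b z Z * z.2 Y.1)
        + mu (energy b z) * (fderiv ℝ (fderiv ℝ (energy b)) z X Y * z.2 Z.1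
          + energyForm b z Y * X.2 Z.1
          - fderiv ℝ (fderiv ℝ (energy b)) z X Z * z.2 Y.1 - energyForm b z Z * X.2 Y.1) := by
  have hnhds := hb.isOpen_prod.mem_nhds (show z ∈ U ×ˢ Set.univ from ⟨hz, trivial⟩)
  have hH := (((hb.contDiffOn_energy.fderiv_of_isOpen hb.isOpen_prod
    (m := ∞) (by simp)).contDiffAt hnhds).differentiableAt (by simp)).hasFDerivAt
  have hE : ∀ Y, HasFDerivAt (fun w => energyForm b w Y)
      ((fderiv ℝ (fderiv ℝ (energy b)) z).flip Y) z := by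
    intro Y
    refine ((hH.clm_apply (hasFDerivAt_const Y z)).congr_of_eventuallyEq ?_).congr_fderiv ?_
    · filter_upwards [hnhds] with w hw
      rw [(hb.hasFDerivAt_energy hw.1).fderiv]
    · ext <;> simp
  have hp : ∀ v : E, HasFDerivAt (fun w : E × (E →L[ℝ] ℝ) => w.2 v)
      ((ContinuousLinearMap.apply ℝ ℝ v) ∘L ContinuousLinearMap.snd ℝ E (E →L[ℝ] ℝ)) z := fun v =>
    ((ContinuousLinearMap.apply ℝ ℝ v).hasFDerivAt).comp z hasFDerivAt_snd
  have h := ((hb.hasFDerivAt_comp_energy hz hk.lam_smooth).mul_const (Y.2 Z.1 - Z.2 Y.1)).add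
    ((hb.hasFDerivAt_comp_energy hz hk.mu_smooth).mul
      (((hE Y).mul (hp Z.1)).sub ((hE Z).mul (hp Y.1))))
  have h' := h.congr_of_eventuallyEq (f₁ := fun w =>
    fundamentalForm (diagonalG b c₁ d₁ c₂ d₂) (diagonalJ b a₁ b₁ a₂ b₂) w Y Z) (by
      filter_upwards [hnhds] with w hw using hb.fundamentalForm_eq hk hw.1 Y Z)
  rw [h'.fderiv]
  simp
  ring

/-- `dφ = (λ' - μ) dt ∧ dp_i ∧ dq^i`. -/
theorem exteriorDerivative_fundamentalForm (hb : IsRiemannianOn U b)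
    (hk : IsHermitianCoeff c lam mu a₁ b₁ a₂ b₂ c₁ d₁ c₂ d₂) (hz : z.1 ∈ U)
    (X Y Z : E × (E →L[ℝ] ℝ)) :
    fderiv ℝ (fun w => fundamentalForm (diagonalG b c₁ d₁ c₂ d₂) (diagonalJ b a₁ b₁ a₂ b₂) w Y Z)
        z X
      + fderiv ℝ (fun w => fundamentalForm (diagonalG b c₁ d₁ c₂ d₂)
        (diagonalJ b a₁ b₁ a₂ b₂) w Z X) z Y
      + fderiv ℝ (fun w => fundamentalForm (diagonalG b c₁ d₁ c₂ d₂)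
        (diagonalJ b a₁ b₁ a₂ b₂) w X Y) z Z
      = (deriv₀ lam (energy b z) - mu (energy b z))
        * (energyForm b z X * (Y.2 Z.1 - Z.2 Y.1) + energyForm b z Y * (Z.2 X.1 - X.2 Z.1)
          + energyForm b z Z * (X.2 Y.1 - Y.2 X.1)) := by
  have hnhds := hb.isOpen_prod.mem_nhds (show z ∈ U ×ˢ Set.univ from ⟨hz, trivial⟩)
  have hs : ∀ X Y, fderiv ℝ (fderiv ℝ (energy b)) z X Y
      = fderiv ℝ (fderiv ℝ (energy b)) z Y X :=
    ((hb.contDiffOn_energy.contDiffAt hnhds).isSymmSndFDerivAt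
      (by rw [minSmoothness_of_isRCLikeNormedField]; exact WithTop.coe_le_coe.2 le_top)).eq
  rw [hb.fderiv_fundamentalForm hk hz, hb.fderiv_fundamentalForm hk hz,
    hb.fderiv_fundamentalForm hk hz, hs Y X, hs Z X, hs Z Y]
  ring

theorem isClosedFormOn_fundamentalForm (hb : IsRiemannianOn U b)
    (hk : IsHermitianCoeff c lam mu a₁ b₁ a₂ b₂ c₁ d₁ c₂ d₂)
    (h : ∀ t, 0 ≤ t → mu t = deriv₀ lam t) :
    IsClosedFormOn (U ×ˢ Set.univ)
      (fundamentalForm (diagonalG b c₁ d₁ c₂ d₂) (diagonalJ b a₁ b₁ a₂ b₂)) := by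
  intro z hz X Y Z
  rw [hb.exteriorDerivative_fundamentalForm hk hz.1, h _ (hb.energy_nonneg hz.1), sub_self,
    zero_mul]

theorem mu_eq_of_isClosedFormOn (hb : IsRiemannianOn U b) (hU : U.Nonempty)
    (hn : 2 ≤ Module.finrank ℝ E)
    (hk : IsHermitianCoeff c lam mu a₁ b₁ a₂ b₂ c₁ d₁ c₂ d₂)
    (h : IsClosedFormOn (U ×ˢ Set.univ)
      (fundamentalForm (diagonalG b c₁ d₁ c₂ d₂) (diagonalJ b a₁ b₁ a₂ b₂)))
    {t : ℝ} (ht : 0 < t) : mu t = deriv₀ lam t := by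
  obtain ⟨x, hx⟩ := hU
  have : Nontrivial E := Module.nontrivial_of_finrank_pos (R := ℝ) (by omega)
  obtain ⟨e, he⟩ := exists_ne (0 : E)
  have hpos := hb.pos x hx e he
  obtain ⟨s, hs⟩ : ∃ s : E, b x s s = 2 * t := by
    -- Scaled so that the covector `g(s, ·)` has energy `t`.
    refine ⟨√(2 * t / b x e e) • e, ?_⟩
    have hr : √(2 * t / b x e e) * √(2 * t / b x e e) = 2 * t / b x e e :=
      Real.mul_self_sqrt (by positivity)
    simp only [map_smul, _root_.smul_apply, smul_eq_mul, ← mul_assoc, hr]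
    field_simp
  -- Dimension at least 2 enters here: a nonzero `w` orthogonal to `s`.
  obtain ⟨w, hw, hw₀⟩ := Submodule.exists_mem_ne_zero_of_ne_bot
    (LinearMap.ker_ne_bot_of_finrank_lt (f := (b x s : E →ₗ[ℝ] ℝ)) (by
      rw [Module.finrank_self]; omega))
  have hw : b x s w = 0 := hw
  have hE : energy b (x, b x s) = t := by
    rw [energy, hb.sharp_apply hx, hs]
    ring
  -- `dt` is `2t` on the first vector and zero on the others, so `dφ = (λ' - μ) · 2t · g(w, w)`
  -- here.
  have key := h (x, b x s) ⟨hx, trivial⟩ (verticalLift E (b x s)) (verticalLift E (b x w))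
    (horizontalLift b (x, b x s) w)
  rw [hb.exteriorDerivative_fundamentalForm hk hx, hE, energyForm_horizontalLift,
    energyForm_verticalLift, energyForm_verticalLift] at key
  simp only [hb.sharp_apply hx, hs, hb.symm x hx w s, hw] at key
  simp [verticalLift, horizontalLift_fst] at key
  rcases key with h₁ | h₁ | h₁
  · linarith
  · exact absurd h₁ ht.ne'
  · exact absurd h₁ (hb.pos x hx w hw₀).ne'

end IsRiemannianOn

end Kahler

/-! ### Charts of the manifold -/

section Manifold

variable {n : ℕ} {M : Type*} [TopologicalSpace M] [ChartedSpace (EuclideanSpace ℝ (Fin n)) M]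
  [IsManifold (𝓡 n) ∞ M]

omit [IsManifold (𝓡 n) ∞ M] in
theorem mdifferentiable_of_mem_maximalAtlas
    {e : OpenPartialHomeomorph M (EuclideanSpace ℝ (Fin n))}
    (he : e ∈ IsManifold.maximalAtlas (𝓡 n) ∞ M) : e.MDifferentiable (𝓡 n) (𝓡 n) :=
  ⟨(contMDiffOn_of_mem_maximalAtlas he).mdifferentiableOn (by simp),
    (contMDiffOn_symm_of_mem_maximalAtlas he).mdifferentiableOn (by simp)⟩

/-- A coordinate vector field is a constant field pushed through the tangent map of the inverse
chart. -/
theorem contMDiffOn_mfderiv_symm_apply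
    {e : OpenPartialHomeomorph M (EuclideanSpace ℝ (Fin n))}
    (he : e ∈ IsManifold.maximalAtlas (𝓡 n) ∞ M) (u : EuclideanSpace ℝ (Fin n)) :
    ContMDiffOn (𝓡 n) (𝓡 n).tangent ∞
      (fun x : EuclideanSpace ℝ (Fin n) =>
        (⟨e.symm x, mfderiv (𝓡 n) (𝓡 n) e.symm x u⟩ : TangentBundle (𝓡 n) M)) e.target := by
  have h₁ := (contMDiffOn_symm_of_mem_maximalAtlas he).contMDiffOn_tangentMapWithin
    (m := ∞) (by simp) e.open_target.uniqueMDiffOn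
  have h₂ : ContMDiffOn (𝓡 n) (𝓡 n).tangent ∞
      (fun x : EuclideanSpace ℝ (Fin n) =>
        (⟨x, u⟩ : TangentBundle (𝓡 n) (EuclideanSpace ℝ (Fin n)))) e.target :=
    contMDiffOn_vectorSpace_iff_contDiffOn.2 contDiffOn_const
  refine (h₁.comp h₂ fun x hx => hx).congr fun x hx => ?_
  simp only [Function.comp, tangentMapWithin]
  rw [mfderivWithin_of_isOpen e.open_target hx]

theorem contDiffOn_metricInChart
    (g : Bundle.ContMDiffRiemannianMetric (𝓡 n) ∞ (EuclideanSpace ℝ (Fin n))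
      (fun x : M => TangentSpace (𝓡 n) x))
    {e : OpenPartialHomeomorph M (EuclideanSpace ℝ (Fin n))}
    (he : e ∈ IsManifold.maximalAtlas (𝓡 n) ∞ M) :
    ContDiffOn ℝ ∞ (metricInChart g e) e.target := by
  rw [contDiffOn_clm_apply]
  intro u
  rw [contDiffOn_clm_apply]
  intro v
  have h : ContMDiffOn (𝓡 n) ((𝓡 n).prod 𝓘(ℝ, ℝ)) ∞
      (fun x : EuclideanSpace ℝ (Fin n) =>
        Bundle.TotalSpace.mk' ℝ (E := Bundle.Trivial M ℝ) (e.symm x)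
          (g.inner (e.symm x) (mfderiv (𝓡 n) (𝓡 n) e.symm x u)
            (mfderiv (𝓡 n) (𝓡 n) e.symm x v))) e.target := by
    refine ContMDiffOn.clm_bundle_apply₂ (F₁ := EuclideanSpace ℝ (Fin n))
      (F₂ := EuclideanSpace ℝ (Fin n)) ?_ (contMDiffOn_mfderiv_symm_apply he u)
      (contMDiffOn_mfderiv_symm_apply he v)
    exact g.contMDiff.comp_contMDiffOn (contMDiffOn_symm_of_mem_maximalAtlas he)
  intro x hx
  have hx := h x hx
  rw [Bundle.contMDiffWithinAt_totalSpace] at hx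
  exact hx.2.contDiffWithinAt

theorem isRiemannianOn_metricInChart
    (g : Bundle.ContMDiffRiemannianMetric (𝓡 n) ∞ (EuclideanSpace ℝ (Fin n))
      (fun x : M => TangentSpace (𝓡 n) x))
    {e : OpenPartialHomeomorph M (EuclideanSpace ℝ (Fin n))}
    (he : e ∈ IsManifold.maximalAtlas (𝓡 n) ∞ M) :
    IsRiemannianOn e.target (metricInChart g e) where
  isOpen := e.open_target
  contDiffOn := contDiffOn_metricInChart g he
  symm x _ u v := by
    rw [metricInChart_apply, metricInChart_apply]
    exact g.symm (e.symm x) _ _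
  pos x hx u hu := by
    have hinj := (mdifferentiable_of_mem_maximalAtlas he).symm.mfderiv_injective hx
    have hne : mfderiv (𝓡 n) (𝓡 n) e.symm x u ≠ 0 := fun h =>
      hu (hinj (h.trans (map_zero (mfderiv (𝓡 n) (𝓡 n) e.symm x)).symm))
    rw [metricInChart_apply]
    exact g.pos (e.symm x) _ hne

end Manifold

/-! ### The given coefficients -/

section Coefficients

variable {A c : ℝ} {lam mu : ℝ → ℝ}

theorem contDiffOn_deriv₀ {f : ℝ → ℝ} (hf : ContDiffOn ℝ ∞ f (Set.Ici 0)) :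
    ContDiffOn ℝ ∞ (deriv₀ f) (Set.Ici 0) :=
  hf.derivWithin (uniqueDiffOn_Ici 0) (by simp)

theorem deriv₀_coeffA₁ (hlam_smooth : ContDiffOn ℝ ∞ lam (Set.Ici 0))
    (hlam : ∀ t : ℝ, 0 ≤ t → 0 < lam t) {t : ℝ} (ht : 0 ≤ t) :
    deriv₀ (coeffA₁ A lam) t = -(A * deriv₀ lam t) / lam t ^ 2 := by
  have h : HasDerivWithinAt lam (deriv₀ lam t) (Set.Ici 0) t :=
    (hlam_smooth.differentiableOn (by simp) t ht).hasDerivWithinAt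
  have h' := (hasDerivWithinAt_const t (Set.Ici 0) A).fun_div h (hlam t ht).ne'
  rw [deriv₀]
  refine (h'.derivWithin (uniqueDiffOn_Ici 0 t ht)).trans ?_
  ring

/-- Write `N = A² - 2ctλ²`, `D = λ + 2tλ'`, `K = cλ³ + A²λ'`. The identity `A² D - 2tK = λN` gives
`a₁ + 2 t b₁ = N / (A D)` and the reciprocal value for `a₂ + 2 t b₂`; integrability uses `K - λ' N =
c λ² D`. -/
theorem isHermitianCoeff (hA : 0 < A)
    (hlam_smooth : ContDiffOn ℝ ∞ lam (Set.Ici 0)) (hmu_smooth : ContDiffOn ℝ ∞ mu (Set.Ici 0))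
    (hlam : ∀ t : ℝ, 0 ≤ t → 0 < lam t)
    (hratio : ∀ t : ℝ, 0 ≤ t →
      0 < (A ^ 2 - 2 * c * t * lam t ^ 2) / (lam t + 2 * t * deriv₀ lam t))
    (hlammu : ∀ t : ℝ, 0 ≤ t → 0 < lam t + 2 * t * mu t) :
    IsHermitianCoeff c lam mu (coeffA₁ A lam) (coeffB₁ A c lam) (coeffA₂ A lam) (coeffB₂ A c lam)
      (coeffC₁ A) (coeffD₁ A c lam mu) (coeffC₂ A lam) (coeffD₂ A c lam mu) := by
  have hA' := hA.ne'
  have hl : ∀ t, 0 ≤ t → lam t ≠ 0 := fun t ht => (hlam t ht).ne'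
  -- Positivity of the ratio makes both `N` and `D` nonzero, since division by zero yields `0`.
  have hN : ∀ t, 0 ≤ t → A ^ 2 - 2 * c * t * lam t ^ 2 ≠ 0 := fun t ht h => by
    simpa [h] using hratio t ht
  have hD : ∀ t, 0 ≤ t → lam t + 2 * t * deriv₀ lam t ≠ 0 := fun t ht h => by
    simpa [h] using hratio t ht
  have sd := contDiffOn_deriv₀ hlam_smooth
  have hid : ContDiffOn ℝ ∞ (fun t : ℝ => t) (Set.Ici 0) := contDiffOn_id
  have sA : ContDiffOn ℝ ∞ (fun _ : ℝ => A) (Set.Ici 0) := contDiffOn_const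
  have sK : ContDiffOn ℝ ∞ (fun t => c * lam t ^ 3 + A ^ 2 * deriv₀ lam t) (Set.Ici 0) :=
    (contDiffOn_const.mul (hlam_smooth.pow 3)).add (contDiffOn_const.mul sd)
  have sD : ContDiffOn ℝ ∞ (fun t => lam t + 2 * t * deriv₀ lam t) (Set.Ici 0) :=
    hlam_smooth.add ((contDiffOn_const.mul hid).mul sd)
  have sN : ContDiffOn ℝ ∞ (fun t => A ^ 2 - 2 * c * t * lam t ^ 2) (Set.Ici 0) :=
    contDiffOn_const.sub ((contDiffOn_const.mul hid).mul (hlam_smooth.pow 2))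
  refine
    { lam_smooth := hlam_smooth
      mu_smooth := hmu_smooth
      a₁_smooth := sA.div hlam_smooth hl
      b₁_smooth := (sK.div ((sA.mul hlam_smooth).mul sD) fun t ht =>
        mul_ne_zero (mul_ne_zero hA' (hl t ht)) (hD t ht)).neg
      a₂_smooth := hlam_smooth.div sA fun _ _ => hA'
      b₂_smooth := sK.div (sA.mul sN) fun t ht => mul_ne_zero hA' (hN t ht)
      c₁_smooth := sA
      d₁_smooth := (sK.neg.add (hmu_smooth.mul sN)).div (sA.mul sD) fun t ht =>
        mul_ne_zero hA' (hD t ht)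
      c₂_smooth := (hlam_smooth.pow 2).div sA fun _ _ => hA'
      d₂_smooth := ((hlam_smooth.mul sK).add ((hmu_smooth.mul contDiffOn_const).mul sD)).div
        (sA.mul sN) fun t ht => mul_ne_zero hA' (hN t ht)
      a₁_mul_a₂ := ?_
      upper_lower := ?_
      lower_upper := ?_
      integrable := ?_
      c₁_mul_a₂ := ?_
      c₁_d₁ := ?_
      c₂_mul_a₁ := ?_
      c₂_d₂ := ?_
      c₁_pos := fun _ _ => hA
      c₁_d₁_pos := ?_
      c₂_pos := fun t ht => div_pos (pow_pos (hlam t ht) 2) hA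
      c₂_d₂_pos := ?_ }
  all_goals
    intro t ht
    have h₁ := hl t ht
    have h₂ := hN t ht
    have h₃ := hD t ht
  · simp only [coeffA₁, coeffA₂]
    field_simp
  · simp only [coeffA₁, coeffA₂, coeffB₁, coeffB₂]
    -- `N` and `D` are kept as nonzero atoms while denominators are cleared, then expanded for the
    -- polynomial identity.
    generalize hN' : A ^ 2 - 2 * c * t * lam t ^ 2 = N at *
    generalize hD' : lam t + 2 * t * deriv₀ lam t = D at *
    field_simp
    subst hN' hD'
    ring
  · simp only [coeffA₁, coeffA₂, coeffB₁, coeffB₂]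
    generalize hN' : A ^ 2 - 2 * c * t * lam t ^ 2 = N at *
    generalize hD' : lam t + 2 * t * deriv₀ lam t = D at *
    field_simp
    subst hN' hD'
    ring
  · rw [deriv₀_coeffA₁ hlam_smooth hlam ht]
    simp only [coeffA₁, coeffB₁]
    generalize hN' : A ^ 2 - 2 * c * t * lam t ^ 2 = N at *
    generalize hD' : lam t + 2 * t * deriv₀ lam t = D at *
    field_simp
    subst hN' hD'
    ring
  · simp only [coeffC₁, coeffA₂]
    field_simp
  · simp only [coeffA₂, coeffB₂, coeffC₁, coeffD₁]
    generalize hN' : A ^ 2 - 2 * c * t * lam t ^ 2 = N at *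
    generalize hD' : lam t + 2 * t * deriv₀ lam t = D at *
    field_simp
    subst hN' hD'
    ring
  · simp only [coeffC₂, coeffA₁]
    field_simp
  · simp only [coeffA₁, coeffB₁, coeffC₂, coeffD₂]
    generalize hN' : A ^ 2 - 2 * c * t * lam t ^ 2 = N at *
    generalize hD' : lam t + 2 * t * deriv₀ lam t = D at *
    field_simp
    subst hN' hD'
    ring
  · have h : coeffC₁ A t + 2 * t * coeffD₁ A c lam mu t
        = (A ^ 2 - 2 * c * t * lam t ^ 2) / (lam t + 2 * t * deriv₀ lam t)
          * ((lam t + 2 * t * mu t) / A) := by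
      simp only [coeffC₁, coeffD₁]
      generalize hN' : A ^ 2 - 2 * c * t * lam t ^ 2 = N at *
      generalize hD' : lam t + 2 * t * deriv₀ lam t = D at *
      field_simp
      subst hN' hD'
      ring
    rw [h]
    exact mul_pos (hratio t ht) (div_pos (hlammu t ht) hA)
  · have h : coeffC₂ A lam t + 2 * t * coeffD₂ A c lam mu t
        = ((A ^ 2 - 2 * c * t * lam t ^ 2) / (lam t + 2 * t * deriv₀ lam t))⁻¹
          * (A * (lam t + 2 * t * mu t)) := by
      simp only [coeffC₂, coeffD₂]
      generalize hN' : A ^ 2 - 2 * c * t * lam t ^ 2 = N at *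
      generalize hD' : lam t + 2 * t * deriv₀ lam t = D at *
      field_simp
      subst hN' hD'
      ring
    rw [h]
    exact mul_pos (inv_pos.2 (hratio t ht)) (mul_pos hA (hlammu t ht))

end Coefficients

end CotangentBundle

end

/-! ### The equivalence -/

theorem theorem7 {n : ℕ} (hn : 2 ≤ n) {M : Type*} [TopologicalSpace M]
    [ChartedSpace (EuclideanSpace ℝ (Fin n)) M] [IsManifold (𝓡 n) ∞ M] [Nonempty M]
    (g : Bundle.ContMDiffRiemannianMetric (𝓡 n) ∞ (EuclideanSpace ℝ (Fin n))
      (fun x : M => TangentSpace (𝓡 n) x))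
    (c : ℝ) (hc : CotangentBundle.HasConstantSectionalCurvature g c)
    (A : ℝ) (hA : 0 < A) (lam mu : ℝ → ℝ)
    (hlam_smooth : ContDiffOn ℝ ∞ lam (Set.Ici 0)) (hmu_smooth : ContDiffOn ℝ ∞ mu (Set.Ici 0))
    (hlam : ∀ t : ℝ, 0 ≤ t → 0 < lam t)
    (hratio : ∀ t : ℝ, 0 ≤ t →
      0 < (A ^ 2 - 2 * c * t * lam t ^ 2) / (lam t + 2 * t * CotangentBundle.deriv₀ lam t))
    (hlammu : ∀ t : ℝ, 0 ≤ t → 0 < lam t + 2 * t * mu t) :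
    CotangentBundle.IsNaturalKahler g A c lam mu ↔
      ∀ t : ℝ, 0 ≤ t → mu t = CotangentBundle.deriv₀ lam t := by
  have hk := CotangentBundle.isHermitianCoeff hA hlam_smooth hmu_smooth hlam hratio hlammu
  constructor
  · intro h
    obtain ⟨x⟩ := ‹Nonempty M›
    have he := IsManifold.chart_mem_maximalAtlas (I := 𝓡 n) (n := ∞) x
    -- One chart suffices, since its fibres already realize every energy. On the zero section `dt =
    -- 0`, so `t = 0` is reached by continuity.
    have h_pos : Set.EqOn mu (CotangentBundle.deriv₀ lam) (Set.Ioi 0) := fun t ht =>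
      (CotangentBundle.isRiemannianOn_metricInChart g he).mu_eq_of_isClosedFormOn
        ⟨_, mem_chart_target _ x⟩ (by rw [finrank_euclideanSpace_fin]; exact hn) hk
        (h _ he).isClosedFormOn ht
    have h_all := h_pos.of_subset_closure hmu_smooth.continuousOn
      (CotangentBundle.contDiffOn_deriv₀ hlam_smooth).continuousOn Set.Ioi_subset_Ici_self
      (closure_Ioi (0 : ℝ)).ge
    exact fun t ht => h_all ht
  · intro h e he
    have hb := CotangentBundle.isRiemannianOn_metricInChart g he
    exact ⟨hb.isHermitianOn (hc e he) hk, hb.isClosedFormOn_fundamentalForm hk h⟩
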